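/- Let $k$ be an algebraically closed field of characteristic zero and let $\mathcal C$ be a fusion category over $k$ (a semisimple rigid $k$-linear monoidal category with finitely many isomorphism classes of simple objects, finite-dimensional Hom spaces and simple unit object). Let a finite group $G$ act on $\mathcal C$ by tensor autoequivalences: $k$-linear monoidal functors $\rho^g$ with monoidal structure $(\rho_2^g)_{A,B}:\rho^g(A\otimes B)\to\rho^g(A)\otimes\rho^g(B)$, and coherent monoidal natural isomorphisms $\rho_2^{g,h}:\rho^g\rho^h\to\rho^{gh}$, $\rho_0:\mathrm{id}\to\rho^e$. Let $\mathcal C^G$ be the equivariantization: its objects are pairs $(X,\mu)$ with isomorphisms $\mu^g:\rho^g(X)\to X$ such that $\mu^g\rho^g(\mu^h)=\mu^{gh}(\rho_2^{g,h})_X$ and $\mu^e(\rho_0)_X=\mathrm{id}_X$, its morphisms are those of $\mathcal C$ that commute with the structure maps, and $(X,\mu)\otimes(X',\mu')=(X\otimes X',(\mu^g\otimes\mu'^g)(\rho_2^g)_{X,X'})$. For a simple object $Y$ of $\mathcal C$ let $G_Y=\{g\in G:\rho^g(Y)\simeq Y\}$, choose isomorphisms $c_Y^g:\rho^g(Y)\to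 Y$ ($g\in G_Y$), and let $\tilde\alpha_Y:G_Y\times G_Y\to k^*$ be given by $\tilde\alpha_Y(g,h)^{-1}\,\mathrm{id}_Y=c_Y^g\,\rho^g(c_Y^h)\,(\rho_2^{g,h})_Y^{-1}\,(c_Y^{gh})^{-1}$. A projective representation $\pi$ of $G_Y$ with factor set $\tilde\alpha_Y$ on a finite-dimensional space $V_\pi$ is a map $\pi:G_Y\to \mathrm{GL}(V_\pi)$ with $\pi(g)\pi(h)=\tilde\alpha_Y(g,h)\pi(gh)$; it is irreducible if $V_\pi\ne 0$ and $V_\pi$ has no invariant subspaces other than $0$ and $V_\pi$. For such an irreducible $\pi$, let $S_{Y,\pi}$ be the simple object $\bigl(\bigoplus_{t\in\mathcal R}\rho^t(V_\pi\otimes Y),\mu\bigr)$ of $\mathcal C^G$, where $\mathcal R$ is a set of representatives of the left cosets of $G_Y$ in $G$ and $\mu^g$ maps $\rho^g\rho^t(V_\pi\otimes Y)$ to $\rho^s(V_\pi\otimes Y)$ by $\rho^s(\pi(h)\otimes c_Y^h)\,(\rho_2^{s,h})^{-1}\rho_2^{g,t}$ for $gt=sh$, $s\in\mathcal R$, $h\in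 G_Y$. For $t\in G$ put ${}^tG_Y=tG_Yt^{-1}$; for $g\in{}^tG_Y$ put ${}^t\pi(g)=\pi(t^{-1}gt)$ and $({}^tc_Y)^g=\rho^t(c_Y^{t^{-1}gt})\,(\rho_2^{t,t^{-1}gt})_Y^{-1}\,(\rho_2^{g,t})_Y:\rho^g\rho^t(Y)\to\rho^t(Y)$. **Theorem 3.9.** Let $U,Y,Z$ be simple objects of $\mathcal C$, and let $\delta,\pi,\gamma$ be irreducible projective representations of $G_U,G_Y,G_Z$ with factor sets $\tilde\alpha_U,\tilde\alpha_Y,\tilde\alpha_Z$. Let $(t_1,s_1),\dots,(t_n,s_n)\in G\times G$ represent the distinct orbits of $G_U$ acting by left multiplication on $G/G_Y\times G/G_Z$. Then the multiplicity of $S_{U,\delta}$ in $S_{Y,\pi}\otimes S_{Z,\gamma}$ satisfies $$\dim_k\mathrm{Hom}_{\mathcal C^G}(S_{U,\delta},S_{Y,\pi}\otimes S_{Z,\gamma})=\sum_{D\in G_Y\backslash G/G_Z}\ \sum_{\substack{1\le i\le n\\ t_i^{-1}s_i\in D\\ \mathrm{Hom}_{\mathcal C}(U,\rho^{t_i}Y\otimes\rho^{s_i}Z)\neq0}}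 m_{T_i}\bigl(\delta|_{T_i},\ {}^{t_i}\pi|_{T_i}\otimes{}^{s_i}\gamma|_{T_i}\otimes\tau_U^{t_i,s_i}(Y,Z)\bigr),$$ where $T_i=G_U\cap{}^{t_i}G_Y\cap{}^{s_i}G_Z$; where $\tau_U^{t,s}(Y,Z)$ is the space $\mathrm{Hom}_{\mathcal C}(U,\rho^tY\otimes\rho^sZ)$ with the projective action $g\cdot f=\bigl(({}^tc_Y)^g\otimes({}^sc_Z)^g\bigr)(\rho_2^g)_{\rho^tY,\rho^sZ}\,\rho^g(f)\,(c_U^g)^{-1}$ of $G_U\cap{}^tG_Y\cap{}^sG_Z$; and where $m_T(\pi',\pi'')=\dim_k\{\varphi:V_{\pi'}\to V_{\pi''}\ k\text{-linear} : \varphi\,\pi'(g)=\pi''(g)\,\varphi\ \ \forall g\in T\}$ is the multiplicity form for projective representations of $T$ with the same factor set (here both arguments have the factor set $\tilde\alpha_U|_{T_i}$). -/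

import Mathlib

open CategoryTheory CategoryTheory.Limits CategoryTheory.MonoidalCategory
open scoped Pointwise

attribute [local instance] Abelian.hasFiniteBiproducts

namespace Equivariantization

universe w v u

/-- A fusion category over `k`: a semisimple `k`-linear abelian rigid monoidal category with
finitely many isomorphism classes of simple objects, finite-dimensional Hom spaces and simple unit
object. -/
class FusionCategory (k : Type w) [Field k] (C : Type u) [Category.{v} C] [Abelian C] [Linear k C]
    [MonoidalCategory C] [MonoidalPreadditive C] [MonoidalLinear k C] [RigidCategory C] :
    Prop where
  finite_hom : ∀ X Y : C, FiniteDimensional k (X ⟶ Y)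
  semisimple : ∀ X : C, ∃ (n : ℕ) (S : Fin n → C), (∀ i, Simple (S i)) ∧ Nonempty (X ≅ ⨁ S)
  finite_simple : ∃ (n : ℕ) (S : Fin n → C), ∀ X : C, Simple X → ∃ i, Nonempty (X ≅ S i)
  simple_unit : Simple (𝟙_ C)

section Projective

variable {k : Type*} [Field k] {G H : Type*} [Group G] [Group H]

/-- A projective representation of `G` on `V` with factor set `α`: a map `π : G → GL(V)` such that
`π(g) π(h) = α(g, h) π(gh)`. -/
structure ProjRep (k : Type*) [Field k] {G : Type*} [Group G] (α : G → G → kˣ) (V : Type*)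
    [AddCommGroup V] [Module k V] where
  toFun : G → (V →ₗ[k] V)
  bijective : ∀ g, Function.Bijective (toFun g)
  map_mul : ∀ (g h : G) (x : V), toFun g (toFun h x) = (α g h : k) • toFun (g * h) x

namespace ProjRep

variable {α β : G → G → kˣ} {V W : Type*} [AddCommGroup V] [Module k V] [AddCommGroup W]
  [Module k W]

/-- `π` is irreducible: `V` is nonzero and `0` and `V` are the only invariant subspaces. -/
def IsIrreducible (π : ProjRep k α V) : Prop :=
  Nontrivial V ∧ ∀ S : Submodule k V, (∀ g, ∀ x ∈ S, π.toFun g x ∈ S) → S = ⊥ ∨ S = ⊤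

lemma map_one (π : ProjRep k α V) (x : V) : π.toFun 1 x = (α 1 1 : k) • x := by
  obtain ⟨y, rfl⟩ := (π.bijective 1).2 x
  rw [π.map_mul, one_mul]

/-- Pull-back of a projective representation along a group homomorphism (in particular restriction
to a subgroup). -/
def comap (f : H →* G) (π : ProjRep k α V) : ProjRep k (fun g h => α (f g) (f h)) V where
  toFun g := π.toFun (f g)
  bijective g := π.bijective (f g)
  map_mul g h x := by rw [π.map_mul, _root_.map_mul]

/-- The tensor product of two projective representations; the factor sets multiply. -/
noncomputable def tensor (π : ProjRep k α V) (γ : ProjRep k β W) :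
    ProjRep k (α * β) (TensorProduct k V W) where
  toFun g := TensorProduct.map (π.toFun g) (γ.toFun g)
  bijective g := (TensorProduct.congr (LinearEquiv.ofBijective _ (π.bijective g))
    (LinearEquiv.ofBijective _ (γ.bijective g))).bijective
  map_mul g h x := by
    have e : TensorProduct.map (π.toFun g) (γ.toFun g) ∘ₗ TensorProduct.map (π.toFun h) (γ.toFun h)
        = (((α * β) g h : kˣ) : k) • TensorProduct.map (π.toFun (g * h)) (γ.toFun (g * h)) := by
      ext x y
      simp [π.map_mul, γ.map_mul, TensorProduct.smul_tmul', TensorProduct.tmul_smul, smul_smul,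
        mul_comm]
    exact LinearMap.congr_fun e x

/-- The same projective representation, its factor set being rewritten along an equality. -/
def ofEq (h : α = β) (π : ProjRep k α V) : ProjRep k β V where
  toFun := π.toFun
  bijective := π.bijective
  map_mul := by subst h; exact π.map_mul

/-- The space of intertwiners between two projective representations with the same factor set,
that is, of homomorphisms of modules over the twisted group algebra. -/
def intertwiners (π' : ProjRep k α V) (π : ProjRep k α W) : Submodule k (V →ₗ[k] W) where
  carrier := {φ | ∀ g x, φ (π'.toFun g x) = π.toFun g (φ x)}
  add_mem' h h' g x := by simp [h g x, h' g x]
  zero_mem' g x := by simp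
  smul_mem' c φ h g x := by simp [h g x]

/-- The multiplicity (intertwining number) `m_G(π', π)` of `π'` in `π`. -/
noncomputable def mult (π' : ProjRep k α V) (π : ProjRep k α W) : ℕ :=
  Module.finrank k (intertwiners π' π)

end ProjRep

end Projective

section Action

variable (k : Type w) [Field k] (G : Type*) [Group G] (C : Type u) [Category.{v} C] [Abelian C]
  [Linear k C]

/-- An action of the group `G` on the `k`-linear category `C` by `k`-linear autoequivalences: functors `ρ^g`
(`F g`), coherent natural isomorphisms `ρ^g ρ^h ≅ ρ^{gh}` and `id ≅ ρ^e`. The first family is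
indexed by triples with `g * h = x`, which spares transports along `(ab)c = a(bc)`. -/
structure CatAction where
  F : G → C ⥤ C
  additive : ∀ g, (F g).Additive
  linear : ∀ g, (F g).Linear k
  mulIso : ∀ {g h x : G}, g * h = x → (F h ⋙ F g ≅ F x)
  unitIso : 𝟭 C ≅ F 1
  assoc : ∀ {a b c ab bc abc : G} (hab : a * b = ab) (hbc : b * c = bc) (h : ab * c = abc)
    (h' : a * bc = abc) (X : C),
    (mulIso hab).hom.app ((F c).obj X) ≫ (mulIso h).hom.app X =
      (F a).map ((mulIso hbc).hom.app X) ≫ (mulIso h').hom.app X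
  left_unit : ∀ (a : G) (X : C),
    unitIso.hom.app ((F a).obj X) ≫ (mulIso (one_mul a)).hom.app X = 𝟙 _
  right_unit : ∀ (a : G) (X : C),
    (F a).map (unitIso.hom.app X) ≫ (mulIso (mul_one a)).hom.app X = 𝟙 _

/-- An action of `G` on the monoidal category `C` by tensor autoequivalences: the functors `ρ^g`
are (strong) monoidal and the structural isomorphisms are monoidal. -/
structure TensorAction [MonoidalCategory C] extends CatAction k G C where
  monoidal : ∀ g, (F g).Monoidal
  mulIso_monoidal : ∀ {g h x : G} (e : g * h = x), NatTrans.IsMonoidal (mulIso e).hom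
  unitIso_monoidal : NatTrans.IsMonoidal unitIso.hom

attribute [instance] CatAction.additive CatAction.linear TensorAction.monoidal
  TensorAction.mulIso_monoidal TensorAction.unitIso_monoidal

end Action

namespace CatAction

variable {k : Type w} [Field k] {G : Type*} [Group G] {C : Type u} [Category.{v} C] [Abelian C]
  [Linear k C] (ρ : CatAction k G C)

/-- Restriction of an action to a subgroup. -/
def restrict (H : Subgroup G) : CatAction k H C where
  F g := ρ.F g
  additive g := ρ.additive g
  linear g := ρ.linear g
  mulIso e := ρ.mulIso (congrArg Subtype.val e)
  unitIso := ρ.unitIso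
  assoc _ _ _ _ X := ρ.assoc _ _ _ _ X
  left_unit a X := ρ.left_unit a X
  right_unit a X := ρ.right_unit a X

/-- The functors of an action are autoequivalences. -/
instance isEquivalence (g : G) : (ρ.F g).IsEquivalence :=
  (CategoryTheory.Equivalence.mk (ρ.F g) (ρ.F g⁻¹)
    (ρ.unitIso ≪≫ (ρ.mulIso (inv_mul_cancel g)).symm)
    (ρ.mulIso (mul_inv_cancel g) ≪≫ ρ.unitIso.symm)).isEquivalence_functor

/-- The inertia subgroup `G_Y = {g | ρ^g(Y) ≅ Y}`. -/
def inertia (Y : C) : Subgroup G where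
  carrier := {g | Nonempty ((ρ.F g).obj Y ≅ Y)}
  one_mem' := ⟨(ρ.unitIso.app Y).symm⟩
  mul_mem' := by
    rintro a b ⟨i⟩ ⟨j⟩
    exact ⟨((ρ.mulIso rfl).app Y).symm ≪≫ (ρ.F a).mapIso j ≪≫ i⟩
  inv_mem' := by
    rintro a ⟨i⟩
    exact ⟨(ρ.F a⁻¹).mapIso i.symm ≪≫ (ρ.mulIso (inv_mul_cancel a)).app Y ≪≫
      (ρ.unitIso.app Y).symm⟩

/-- Let `c^g : ρ^g(Y) ≅ Y` (`g ∈ H`) be a family of isomorphisms. It has factor set `α` if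
`α(g, h)⁻¹ id_Y = c^g ∘ ρ^g(c^h) ∘ (ρ_2^{g,h})_Y⁻¹ ∘ (c^{gh})⁻¹` for all `g, h ∈ H`. -/
def IsFactorSet {H : Subgroup G} {Y : C} (c : ∀ g : H, (ρ.F g).obj Y ≅ Y) (α : H → H → kˣ) :
    Prop :=
  ∀ g h : H, (((α g h)⁻¹ : kˣ) : k) • 𝟙 Y =
    (c (g * h)).inv ≫ (ρ.mulIso (Subgroup.coe_mul H g h).symm).inv.app Y ≫
      (ρ.F g).map (c h).hom ≫ (c g).hom

variable {ρ} in
lemma IsFactorSet.comp' {H : Subgroup G} {Y : C} {c : ∀ g : H, (ρ.F g).obj Y ≅ Y}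
    {α : H → H → kˣ} (hα : ρ.IsFactorSet c α) (g h : H) :
    (ρ.F g).map (c h).hom ≫ (c g).hom = (((α g h)⁻¹ : kˣ) : k) •
      ((ρ.mulIso (Subgroup.coe_mul H g h).symm).hom.app Y ≫ (c (g * h)).hom) := by
  have := congrArg (fun f => (ρ.mulIso (Subgroup.coe_mul H g h).symm).hom.app Y ≫
    (c (g * h)).hom ≫ f) (hα g h)
  simp only [Iso.hom_inv_id_assoc, Iso.hom_inv_id_app_assoc] at this
  rw [← this]
  simp

variable {ρ} in
lemma IsFactorSet.comp {H : Subgroup G} {Y : C} {c : ∀ g : H, (ρ.F g).obj Y ≅ Y}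
    {α : H → H → kˣ} (hα : ρ.IsFactorSet c α) (g h : H) {x : H} (e : g * h = x) :
    (ρ.F g).map (c h).hom ≫ (c g).hom = (((α g h)⁻¹ : kˣ) : k) •
      ((ρ.mulIso (congrArg Subtype.val e : (g : G) * h = x)).hom.app Y ≫ (c x).hom) := by
  subst e; exact hα.comp' g h

variable {ρ} in
lemma IsFactorSet.unit {H : Subgroup G} {Y : C} {c : ∀ g : H, (ρ.F g).obj Y ≅ Y}
    {α : H → H → kˣ} (hα : ρ.IsFactorSet c α) :
    ρ.unitIso.hom.app Y ≫ (c 1).hom = (((α 1 1)⁻¹ : kˣ) : k) • 𝟙 Y := by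
  have h1 := hα.comp 1 1 (mul_one 1)
  rw [← Linear.smul_comp, cancel_mono] at h1
  apply (ρ.F 1).map_injective
  have h2 := ρ.right_unit 1 Y
  erw [Functor.map_comp, h1, Linear.comp_smul, h2, Functor.map_smul,
    CategoryTheory.Functor.map_id]

/-- For a simple object every family of isomorphisms has a (unique) factor set. -/
lemma existsUnique_isFactorSet [IsAlgClosed k] {H : Subgroup G} {Y : C} [Simple Y]
    [FiniteDimensional k (Y ⟶ Y)] (c : ∀ g : H, (ρ.F g).obj Y ≅ Y) :
    ∃! α : H → H → kˣ, ρ.IsFactorSet c α := by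
  have key : ∀ g h : H, ∃ a : kˣ, ((a⁻¹ : kˣ) : k) • 𝟙 Y =
      (c (g * h)).inv ≫ (ρ.mulIso (Subgroup.coe_mul H g h).symm).inv.app Y ≫
        (ρ.F g).map (c h).hom ≫ (c g).hom := by
    intro g h
    obtain ⟨a, ha⟩ := endomorphism_simple_eq_smul_id k ((c (g * h)).inv ≫
      (ρ.mulIso (Subgroup.coe_mul H g h).symm).inv.app Y ≫ (ρ.F g).map (c h).hom ≫ (c g).hom)
    have h0 : a ≠ 0 := by
      rintro rfl
      rw [zero_smul] at ha
      have : IsIso (0 : Y ⟶ Y) := by rw [ha]; infer_instance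
      exact id_nonzero Y (by rw [← IsIso.hom_inv_id (0 : Y ⟶ Y), zero_comp])
    exact ⟨(Units.mk0 a h0)⁻¹, by simpa using ha⟩
  choose α hα using key
  refine ⟨α, hα, fun β hβ => ?_⟩
  funext g h
  have e := (hβ g h).trans (hα g h).symm
  have := smul_left_injective k (id_nonzero Y) e
  exact inv_injective (Units.ext this)

/-! ### The equivariantization -/

/-- An object `(X, μ)` of the equivariantization `C^G`. -/
structure EquivariantObject where
  X : C
  μ : ∀ g, (ρ.F g).obj X ⟶ X
  map_mul : ∀ g h, (ρ.F g).map (μ h) ≫ μ g = (ρ.mulIso rfl).hom.app X ≫ μ (g * h)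
  map_one : ρ.unitIso.hom.app X ≫ μ 1 = 𝟙 X

namespace EquivariantObject

variable {ρ}

lemma map_mul' (A : EquivariantObject ρ) {g h x : G} (e : g * h = x) :
    (ρ.F g).map (A.μ h) ≫ A.μ g = (ρ.mulIso e).hom.app A.X ≫ A.μ x := by
  subst e; exact A.map_mul g h

/-- The structure maps `μ^g` of an equivariant object are isomorphisms. -/
lemma isIso_μ (A : EquivariantObject ρ) (g : G) : IsIso (A.μ g) := by
  have h1 : IsIso (A.μ 1) := by
    have : A.μ 1 = (ρ.unitIso.inv.app A.X) := by
      rw [← cancel_epi (ρ.unitIso.hom.app A.X), A.map_one]; simp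
    rw [this]; infer_instance
  have e1 := A.map_mul' (mul_inv_cancel g)
  have e2 := A.map_mul' (inv_mul_cancel g)
  have m : Mono (A.μ g) := by
    have : Mono ((ρ.F g⁻¹).map (A.μ g) ≫ A.μ g⁻¹) := by rw [e2]; infer_instance
    have : Mono ((ρ.F g⁻¹).map (A.μ g)) := mono_of_mono _ (A.μ g⁻¹)
    exact (ρ.F g⁻¹).mono_of_mono_map this
  have ep : Epi (A.μ g) := by
    have : Epi ((ρ.F g).map (A.μ g⁻¹) ≫ A.μ g) := by rw [e1]; infer_instance
    exact epi_of_epi ((ρ.F g).map (A.μ g⁻¹)) _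
  exact isIso_of_mono_of_epi _

/-- Morphisms of `C^G`: the morphisms `f` of `C` with `f μ^g = μ'^g ρ^g(f)` for all `g`. -/
def homs (A B : EquivariantObject ρ) : Submodule k (A.X ⟶ B.X) where
  carrier := {f | ∀ g, A.μ g ≫ f = (ρ.F g).map f ≫ B.μ g}
  add_mem' h h' g := by simp [h g, h' g]
  zero_mem' g := by simp
  smul_mem' c f h g := by simp [h g, Functor.map_smul]

/-- The equivariantization `C^G` as a category. -/
instance : Category.{v} (EquivariantObject ρ) where
  Hom A B := homs A B
  id A := ⟨𝟙 A.X, fun g => by simp⟩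
  comp f f' := ⟨f.1 ≫ f'.1, fun g => by
    rw [← Category.assoc, f.2 g, Category.assoc, f'.2 g, Functor.map_comp, Category.assoc]⟩
  id_comp f := Subtype.ext (Category.id_comp f.1)
  comp_id f := Subtype.ext (Category.comp_id f.1)
  assoc f g h := Subtype.ext (Category.assoc f.1 g.1 h.1)

instance (A B : EquivariantObject ρ) : AddCommGroup (A ⟶ B) :=
  inferInstanceAs (AddCommGroup (homs A B))

instance (A B : EquivariantObject ρ) : Module k (A ⟶ B) :=
  inferInstanceAs (Module k (homs A B))

end EquivariantObject

/-! ### Structure maps transported along the action -/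

/-- If `g a = b h` and `m : ρ^h(X) → X`, the composition
`ρ^b(m) ∘ (ρ_2^{b,h})⁻¹ ∘ ρ_2^{g,a} : ρ^g ρ^a(X) → ρ^b(X)`. -/
def cell {X : C} {g a b h : G} (e : b * h = g * a) (m : (ρ.F h).obj X ⟶ X) :
    (ρ.F g).obj ((ρ.F a).obj X) ⟶ (ρ.F b).obj X :=
  (ρ.mulIso (rfl : g * a = g * a)).hom.app X ≫ (ρ.mulIso e).inv.app X ≫ (ρ.F b).map m

lemma cell_comp {X : C} {g g' a b c h h' x y : G} (e : b * h = g * a) (e' : c * h' = g' * b)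
    (m : (ρ.F h).obj X ⟶ X) (m' : (ρ.F h').obj X ⟶ X) (m'' : (ρ.F y).obj X ⟶ X)
    (hx : g' * g = x) (hy : h' * h = y) (e'' : c * y = x * a) (r : k)
    (hm : (ρ.F h').map m ≫ m' = r • ((ρ.mulIso hy).hom.app X ≫ m'')) :
    (ρ.F g').map (ρ.cell e m) ≫ ρ.cell e' m' =
      r • ((ρ.mulIso hx).hom.app _ ≫ ρ.cell e'' m'') := by
  have n1 := (ρ.mulIso (rfl : g' * b = g' * b)).hom.naturality m
  have n2 := (ρ.mulIso e').inv.naturality m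
  have hz : g' * (g * a) = x * a := by rw [← hx, mul_assoc]
  have hz' : (g' * b) * h = x * a := by rw [← hx, mul_assoc, mul_assoc, e]
  have a1 := ρ.assoc e' hy hz' e'' X
  have a2 := ρ.assoc (rfl : g' * b = g' * b) e hz' hz X
  have a3 := ρ.assoc hx (rfl : g * a = g * a) (rfl : x * a = x * a) hz X
  have coh : (ρ.F g').map ((ρ.mulIso (rfl : g * a = g * a)).hom.app X) ≫
      (ρ.F g').map ((ρ.mulIso e).inv.app X) ≫ (ρ.mulIso (rfl : g' * b = g' * b)).hom.app _ ≫
      (ρ.mulIso e').inv.app _ ≫ (ρ.F c).map ((ρ.mulIso hy).hom.app X) =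
      (ρ.mulIso hx).hom.app _ ≫ (ρ.mulIso (rfl : x * a = x * a)).hom.app X ≫
        (ρ.mulIso e'').inv.app X := by
    rw [← cancel_mono ((ρ.mulIso e'').hom.app X)]
    simp only [Category.assoc, Iso.inv_hom_id_app, ← a1, Iso.inv_hom_id_app_assoc, a2]
    rw [← Functor.map_comp_assoc _ ((ρ.mulIso e).inv.app X), Iso.inv_hom_id_app]
    erw [CategoryTheory.Functor.map_id, Category.id_comp, Category.comp_id]
    exact a3.symm
  have hm' := congrArg (ρ.F c).map hm
  simp only [Functor.comp_map] at n1 n2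
  simp only [Functor.map_comp, Functor.map_smul] at hm'
  unfold cell
  simp only [Functor.map_comp, Category.assoc]
  rw [reassoc_of% n1, reassoc_of% n2, hm']
  simp only [Linear.comp_smul, Functor.comp_obj]
  congr 1
  simpa only [Category.assoc, Functor.comp_obj] using
    congrArg (fun f => f ≫ (ρ.F c).map m'') coh

lemma cell_eq {X : C} {g a b h x : G} (e : b * h = g * a) (m : (ρ.F h).obj X ⟶ X)
    (e₁ : g * a = x) (e₂ : b * h = x) :
    ρ.cell e m = (ρ.mulIso e₁).hom.app X ≫ (ρ.mulIso e₂).inv.app X ≫ (ρ.F b).map m := by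
  subst e₁; rfl

lemma cell_one {X : C} {b : G} (e : b * 1 = 1 * b) (m : (ρ.F 1).obj X ⟶ X)
    (hm : ρ.unitIso.hom.app X ≫ m = 𝟙 X) :
    ρ.unitIso.hom.app _ ≫ ρ.cell e m = 𝟙 _ := by
  rw [ρ.cell_eq e m (one_mul b) (mul_one b)]
  have h1 := ρ.left_unit b X
  have h2 : (ρ.mulIso (mul_one b)).inv.app X = (ρ.F b).map (ρ.unitIso.hom.app X) := by
    rw [← cancel_mono ((ρ.mulIso (mul_one b)).hom.app X), ρ.right_unit b X]
    simp
  rw [reassoc_of% h1, h2, ← Functor.map_comp, hm]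
  exact CategoryTheory.Functor.map_id _ _

/-! ### The functor `L` from `C^H` to `C^G` -/

section Induction

variable {ρ} {H : Subgroup G}

lemma section_rel (σ : G ⧸ H → G) (hσ : ∀ q, (σ q : G ⧸ H) = q) (g : G) (q : G ⧸ H) :
    (σ (g • q))⁻¹ * (g * σ q) ∈ H := by
  rw [← QuotientGroup.eq, hσ]
  conv_lhs => rw [← hσ q]
  rfl

instance preservesBiproduct_of_additive (F : C ⥤ C) [F.Additive] {J : Type*} [Finite J]
    (f : J → C) : PreservesBiproduct f F where
  preserves hb := by
    cases nonempty_fintype J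
    refine ⟨isBilimitOfTotal _ ?_⟩
    have h := congrArg F.map (IsBilimit.total hb)
    simp only [F.map_sum, F.map_comp, CategoryTheory.Functor.map_id] at h
    exact h

lemma ι_mapBiproduct_inv (F : C ⥤ C) [F.Additive] {J : Type*} [Finite J] (f : J → C) (j : J) :
    biproduct.ι (F.obj ∘ f) j ≫ (F.mapBiproduct f).inv = F.map (biproduct.ι f j) := by
  rw [Functor.mapBiproduct_inv]
  exact biproduct.ι_desc _ _

lemma map_ι_mapBiproduct_hom (F : C ⥤ C) [F.Additive] {J : Type*} [Finite J] (f : J → C)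
    (j : J) :
    F.map (biproduct.ι f j) ≫ (F.mapBiproduct f).hom = biproduct.ι (F.obj ∘ f) j := by
  rw [← ι_mapBiproduct_inv, Category.assoc, Iso.inv_hom_id, Category.comp_id]

lemma map_biproduct_hom_ext (F : C ⥤ C) [F.Additive] {J : Type*} [Finite J] (f : J → C) {W : C}
    {a b : F.obj (⨁ f) ⟶ W}
    (h : ∀ j, F.map (biproduct.ι f j) ≫ a = F.map (biproduct.ι f j) ≫ b) : a = b := by
  rw [← cancel_epi (F.mapBiproduct f).inv]
  apply biproduct.hom_ext'
  intro j
  rw [← Category.assoc, ← Category.assoc, ι_mapBiproduct_inv]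
  exact h j

variable [Finite (G ⧸ H)]

/-- The structure map `μ^g : ρ^g(⨁_t ρ^t(N)) → ⨁_t ρ^t(N)`; its restriction to the summand of `t`
is `ρ^s(ν^h) ∘ (ρ_2^{s,h})⁻¹ ∘ ρ_2^{g,t} : ρ^g ρ^t(N) → ρ^s(N)`, where `g t = s h`, `h ∈ H`. -/
noncomputable def induceMap (N : EquivariantObject (ρ.restrict H)) (σ : G ⧸ H → G)
    (hσ : ∀ q, (σ q : G ⧸ H) = q) (g : G) :
    (ρ.F g).obj (⨁ fun q : G ⧸ H => (ρ.F (σ q)).obj N.X) ⟶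
      ⨁ fun q : G ⧸ H => (ρ.F (σ q)).obj N.X :=
  ((ρ.F g).mapBiproduct (fun q : G ⧸ H => (ρ.F (σ q)).obj N.X)).hom ≫
    biproduct.desc (fun q : G ⧸ H =>
      ρ.cell (h := (σ (g • q))⁻¹ * (g * σ q)) (mul_inv_cancel_left _ _)
        (N.μ ⟨(σ (g • q))⁻¹ * (g * σ q), section_rel σ hσ g q⟩) ≫
      biproduct.ι (fun q : G ⧸ H => (ρ.F (σ q)).obj N.X) (g • q))

lemma map_ι_induceMap (N : EquivariantObject (ρ.restrict H)) (σ : G ⧸ H → G)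
    (hσ : ∀ q, (σ q : G ⧸ H) = q) (g : G) (q q' : G ⧸ H) (hq : g • q = q') (h : H)
    (e : σ q' * h = g * σ q) :
    (ρ.F g).map (biproduct.ι (fun q : G ⧸ H => (ρ.F (σ q)).obj N.X) q) ≫ induceMap N σ hσ g =
      ρ.cell e (N.μ h) ≫ biproduct.ι (fun q : G ⧸ H => (ρ.F (σ q)).obj N.X) q' := by
  subst hq
  have hh : h = ⟨(σ (g • q))⁻¹ * (g * σ q), section_rel σ hσ g q⟩ :=
    Subtype.ext (eq_inv_mul_of_mul_eq e)
  subst hh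
  have e1 := map_ι_mapBiproduct_hom (ρ.F g) (fun q : G ⧸ H => (ρ.F (σ q)).obj N.X) q
  unfold induceMap
  rw [reassoc_of% e1, biproduct.ι_desc]

/-- The object `L(N, ν) = (⨁_t ρ^t(N), μ)` of `C^G`, where `t = σ(q)` runs over the set of
representatives of the left cosets of `H` in `G` given by a section `σ` of `G → G/H`. -/
noncomputable def induce (N : EquivariantObject (ρ.restrict H)) (σ : G ⧸ H → G)
    (hσ : ∀ q, (σ q : G ⧸ H) = q) : EquivariantObject ρ where
  X := ⨁ fun q : G ⧸ H => (ρ.F (σ q)).obj N.X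
  μ := induceMap N σ hσ
  map_mul g g' := by
    apply map_biproduct_hom_ext (ρ.F g' ⋙ ρ.F g)
    intro q
    have h1 := map_ι_induceMap N σ hσ g' q (g' • q) rfl ⟨_, section_rel σ hσ g' q⟩
      (mul_inv_cancel_left _ _)
    have h2 := map_ι_induceMap N σ hσ g (g' • q) (g • g' • q) rfl ⟨_, section_rel σ hσ g _⟩
      (mul_inv_cancel_left _ _)
    have e : σ (g • g' • q) * (((σ (g • g' • q))⁻¹ * (g * σ (g' • q))) *
        ((σ (g' • q))⁻¹ * (g' * σ q))) = (g * g') * σ q := by group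
    have h3 := map_ι_induceMap N σ hσ (g * g') q (g • g' • q) (mul_smul g g' q)
      (⟨_, section_rel σ hσ g (g' • q)⟩ * ⟨_, section_rel σ hσ g' q⟩) e
    have nat := (ρ.mulIso (rfl : g * g' = g * g')).hom.naturality
      (biproduct.ι (fun q : G ⧸ H => (ρ.F (σ q)).obj N.X) q)
    rw [Functor.comp_map] at nat ⊢
    rw [← Functor.map_comp_assoc, h1, Functor.map_comp_assoc, h2, reassoc_of% nat, h3,
      ← Category.assoc, ← Category.assoc]
    congr 1
    have := ρ.cell_comp (g := g') (g' := g) (a := σ q) (b := σ (g' • q)) (c := σ (g • g' • q))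
      (mul_inv_cancel_left _ _) (mul_inv_cancel_left _ _)
      (N.μ ⟨_, section_rel σ hσ g' q⟩) (N.μ ⟨_, section_rel σ hσ g (g' • q)⟩)
      (N.μ (⟨_, section_rel σ hσ g (g' • q)⟩ * ⟨_, section_rel σ hσ g' q⟩)) rfl rfl e (1 : k)
      (by
        rw [one_smul]
        exact N.map_mul ⟨_, section_rel σ hσ g (g' • q)⟩ ⟨_, section_rel σ hσ g' q⟩)
    rw [one_smul] at this
    exact this
  map_one := by
    apply biproduct.hom_ext'
    intro q
    have h1 := map_ι_induceMap N σ hσ 1 q q (one_smul _ _) 1 (by simp)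
    have nat := ρ.unitIso.hom.naturality (biproduct.ι (fun q : G ⧸ H => (ρ.F (σ q)).obj N.X) q)
    rw [Functor.id_map] at nat
    have h2 := ρ.cell_one (X := N.X) (b := σ q) (by simp) (N.μ 1) N.map_one
    have h3 := congrArg (fun f => f ≫ biproduct.ι (fun q : G ⧸ H => (ρ.F (σ q)).obj N.X) q) h2
    simp only [Category.assoc] at h3
    rw [reassoc_of% nat, h1, Category.comp_id]
    exact h3.trans (Category.id_comp _)

end Induction

/-! ### The objects `S_{Y,π}` -/

section Simple

variable (k) in
/-- The object `V ⊗ Y` of `C`, for `V` a finite-dimensional vector space: the direct sum of copies of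
`Y` indexed by a basis of `V`. -/
noncomputable def copower (V : Type*) [AddCommGroup V] [Module k V] (Y : C) : C :=
  ⨁ fun _ : Fin (Module.finrank k V) => Y

variable {V : Type*} [AddCommGroup V] [Module k V] [FiniteDimensional k V]

/-- The morphism `Y → V ⊗ Y` given by a vector of `V`: the basis vectors give the inclusions of the
summands. -/
noncomputable def ins (V : Type*) [AddCommGroup V] [Module k V] [FiniteDimensional k V] (Y : C) :
    V →ₗ[k] (Y ⟶ copower k V Y) :=
  (Module.finBasis k V).constr k
    (biproduct.ι (fun _ : Fin (Module.finrank k V) => Y))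

variable {ρ} {H : Subgroup G} {Y : C} {c : ∀ g : H, (ρ.F g).obj Y ≅ Y} {α : H → H → kˣ}

/-- For `a : V → V` and `c : ρ^g(Y) → Y`, the morphism `a ⊗ c : ρ^g(V ⊗ Y) = V ⊗ ρ^g(Y) → V ⊗ Y`. -/
noncomputable def copowerMap {g : G} (a : V →ₗ[k] V) (c : (ρ.F g).obj Y ⟶ Y) :
    (ρ.F g).obj (copower k V Y) ⟶ copower k V Y :=
  ((ρ.F g).mapBiproduct (fun _ : Fin (Module.finrank k V) => Y)).hom ≫
    biproduct.desc (fun i => c ≫ ins V Y (a (Module.finBasis k V i)))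

lemma ins_basis (Y : C) (i : Fin (Module.finrank k V)) :
    ins V Y (Module.finBasis k V i) =
      biproduct.ι (fun _ : Fin (Module.finrank k V) => Y) i :=
  (Module.finBasis k V).constr_basis k _ i

lemma copower_hom_ext (F : C ⥤ C) [F.Additive] {W : C}
    {a b : F.obj (copower k V Y) ⟶ W}
    (h : ∀ v : V, F.map (ins (k := k) V Y v) ≫ a = F.map (ins (k := k) V Y v) ≫ b) : a = b := by
  apply map_biproduct_hom_ext F (fun _ : Fin (Module.finrank k V) => Y)
  intro j
  have := h (Module.finBasis k V j)
  rw [ins_basis] at this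
  exact this

lemma map_ins_copowerMap {g : G} (a : V →ₗ[k] V) (c : (ρ.F g).obj Y ⟶ Y) (v : V) :
    (ρ.F g).map (ins (k := k) V Y v) ≫ copowerMap a c = c ≫ ins V Y (a v) := by
  have e : Linear.rightComp k _ (copowerMap a c) ∘ₗ (ρ.F g).mapLinearMap k ∘ₗ ins V Y =
      Linear.leftComp k _ c ∘ₗ ins V Y ∘ₗ a := by
    apply (Module.finBasis k V).ext
    intro i
    simp only [LinearMap.comp_apply, Linear.rightComp_apply, Linear.leftComp_apply, ins_basis]
    have e1 := map_ι_mapBiproduct_hom (ρ.F g) (fun _ : Fin (Module.finrank k V) => Y) i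
    have e2 := congrArg (fun f => f ≫ biproduct.desc
      (fun i => c ≫ ins (k := k) V Y (a (Module.finBasis k V i)))) e1
    simp only [Category.assoc, biproduct.ι_desc] at e2
    exact e2
  exact LinearMap.congr_fun e v

lemma copowerMap_mul (hα : ρ.IsFactorSet c α) (π : ProjRep k α V) (g h : H) :
    (ρ.F g).map (copowerMap (ρ := ρ) (g := h) (π.toFun h) (c h).hom) ≫
        copowerMap (ρ := ρ) (g := g) (π.toFun g) (c g).hom =
      (ρ.mulIso (Subgroup.coe_mul H g h).symm).hom.app (copower k V Y) ≫
        copowerMap (π.toFun (g * h)) (c (g * h)).hom := by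
  apply copower_hom_ext (k := k) (ρ.F h ⋙ ρ.F g)
  intro v
  have nat := (ρ.mulIso (Subgroup.coe_mul H g h).symm).hom.naturality (ins (k := k) V Y v)
  have h1 := map_ins_copowerMap (ρ := ρ) (g := h) (π.toFun h) (c h).hom v
  have h2 := map_ins_copowerMap (ρ := ρ) (g := g) (π.toFun g) (c g).hom (π.toFun h v)
  have h3 := map_ins_copowerMap (ρ := ρ) (g := (g * h : H)) (π.toFun (g * h)) (c (g * h)).hom v
  have h4 := hα.comp g h rfl
  rw [Functor.comp_map] at nat ⊢
  rw [← Functor.map_comp_assoc, h1, Functor.map_comp_assoc, h2, reassoc_of% nat, h3,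
    π.map_mul, _root_.map_smul, Linear.comp_smul, Linear.comp_smul,
    reassoc_of% h4, Linear.smul_comp, smul_smul]
  simp

lemma copowerMap_one (hα : ρ.IsFactorSet c α) (π : ProjRep k α V) :
    ρ.unitIso.hom.app (copower k V Y) ≫
      copowerMap (ρ := ρ) (g := 1) (π.toFun 1) (c 1).hom = 𝟙 _ := by
  apply copower_hom_ext (k := k) (𝟭 C)
  intro v
  have nat := ρ.unitIso.hom.naturality (ins (k := k) V Y v)
  have h1 := map_ins_copowerMap (ρ := ρ) (g := 1) (π.toFun 1) (c 1).hom v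
  have h2 := hα.unit
  have h3 := π.map_one v
  rw [Functor.id_map] at nat
  rw [Functor.id_map, reassoc_of% nat, h1, h3, reassoc_of% h2]
  simp [smul_smul]

/-- The object `(V_π ⊗ Y, ν)` of `C^H`, with `ν^g = π(g) ⊗ c^g`. -/
noncomputable def ofProjRep (hα : ρ.IsFactorSet c α) (π : ProjRep k α V) :
    EquivariantObject (ρ.restrict H) where
  X := copower k V Y
  μ g := copowerMap (ρ := ρ) (g := g) (π.toFun g) (c g).hom
  map_mul g h := copowerMap_mul hα π g h
  map_one := copowerMap_one hα π

/-- The simple object `S_{Y,π} = L(V_π ⊗ Y)` of `C^G`, for a projective representation `π` of the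
inertia subgroup `G_Y` whose factor set is that of a family of isomorphisms `c^g : ρ^g(Y) ≅ Y`;
`σ` picks representatives of the left cosets of `G_Y`. -/
noncomputable def simpleObject [Finite G] {Y : C} {c : ∀ g : ρ.inertia Y, (ρ.F g).obj Y ≅ Y}
    {α : ρ.inertia Y → ρ.inertia Y → kˣ} (hα : ρ.IsFactorSet c α) (π : ProjRep k α V)
    (σ : G ⧸ ρ.inertia Y → G) (hσ : ∀ q, (σ q : G ⧸ ρ.inertia Y) = q) : EquivariantObject ρ :=
  induce (ofProjRep hα π) σ hσ

end Simple

/-! ### Restriction and conjugation of families of isomorphisms -/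

section Families

variable {H : Subgroup G} {Y : C} (c : ∀ g : H, (ρ.F g).obj Y ≅ Y) {α : H → H → kˣ}

lemma isFactorSet_of_comp {c : ∀ g : H, (ρ.F g).obj Y ≅ Y}
    (h : ∀ g h : H, (ρ.F g).map (c h).hom ≫ (c g).hom = (((α g h)⁻¹ : kˣ) : k) •
      ((ρ.mulIso (Subgroup.coe_mul H g h).symm).hom.app Y ≫ (c (g * h)).hom)) :
    ρ.IsFactorSet c α := by
  intro g h'
  rw [h g h']
  simp

variable {ρ}

/-- The conjugation `g ↦ t⁻¹ g t` from `t H t⁻¹` to `H`. -/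
def conjHom (t : G) (H : Subgroup G) : ↥(MulAut.conj t • H) →* H where
  toFun g := ⟨t⁻¹ * g * t, by
    have := Subgroup.mem_pointwise_smul_iff_inv_smul_mem.1 g.2
    simpa [← map_inv, MulAut.smul_def] using this⟩
  map_one' := by ext; simp
  map_mul' g h := by ext; simp [mul_assoc]

/-- The family `(ᵗc)^g = ρ^t(c^{t⁻¹gt}) ∘ (ρ_2^{t,t⁻¹gt})⁻¹ ∘ ρ_2^{g,t} : ρ^g ρ^t(Y) ≅ ρ^t(Y)`,
for `g ∈ t H t⁻¹`. -/
def conjFamily (t : G) (g : ↥(MulAut.conj t • H)) :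
    (ρ.F g).obj ((ρ.F t).obj Y) ≅ (ρ.F t).obj Y :=
  (ρ.mulIso (rfl : (g : G) * t = g * t)).app Y ≪≫
    ((ρ.mulIso (show t * (conjHom t H g : G) = g * t by simp [conjHom, mul_assoc])).app Y).symm ≪≫
    (ρ.F t).mapIso (c (conjHom t H g))

variable {c}

lemma IsFactorSet.conj (hα : ρ.IsFactorSet c α) (t : G) :
    ρ.IsFactorSet (conjFamily c t) (fun g h => α (conjHom t H g) (conjHom t H h)) := by
  apply isFactorSet_of_comp
  intro g h
  have hcj : ∀ g : ↥(MulAut.conj t • H), t * (conjHom t H g : G) = g * t := by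
    intro g; simp [conjHom, mul_assoc]
  have key := ρ.cell_comp (hcj h) (hcj g) (c (conjHom t H h)).hom (c (conjHom t H g)).hom
    (c (conjHom t H (g * h))).hom (Subgroup.coe_mul _ g h).symm
    (by rw [_root_.map_mul]; rfl) (hcj (g * h)) _ 
    (hα.comp (conjHom t H g) (conjHom t H h) (_root_.map_mul _ _ _).symm)
  exact key

lemma IsFactorSet.restrict (hα : ρ.IsFactorSet c α) {T : Subgroup G} (hT : T ≤ H) :
    ρ.IsFactorSet (H := T) (fun g => c (Subgroup.inclusion hT g))
      (fun g h => α (Subgroup.inclusion hT g) (Subgroup.inclusion hT h)) :=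
  fun g h => hα (Subgroup.inclusion hT g) (Subgroup.inclusion hT h)

end Families

end CatAction

namespace TensorAction

variable {k : Type w} [Field k] {G : Type*} [Group G] {C : Type u} [Category.{v} C] [Abelian C]
  [Linear k C] [MonoidalCategory C] (ρ : TensorAction k G C)

open Functor.OplaxMonoidal in
lemma map_δ_comp {g h x : G} (e : g * h = x) (A B : C) :
    (ρ.F g).map (δ (ρ.F h) A B) ≫ δ (ρ.F g) _ _ ≫
      ((ρ.mulIso e).hom.app A ⊗ₘ (ρ.mulIso e).hom.app B) =
    (ρ.mulIso e).hom.app (A ⊗ B) ≫ δ (ρ.F x) A B := by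
  have h1 := NatTrans.IsMonoidal.tensor (τ := (ρ.mulIso e).hom) A B
  rw [Functor.LaxMonoidal.comp_μ, Category.assoc] at h1
  have h2 := congrArg (fun f => (ρ.F g).map (δ (ρ.F h) A B) ≫ δ (ρ.F g) _ _ ≫ f ≫ δ (ρ.F x) A B) h1
  simp only [Category.assoc, Functor.Monoidal.μ_δ, Category.comp_id,
    Functor.Monoidal.δ_μ_assoc] at h2
  rw [← Functor.map_comp_assoc, Functor.Monoidal.δ_μ] at h2
  erw [CategoryTheory.Functor.map_id, Category.id_comp] at h2
  exact h2.symm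

section Tensor

open Functor.OplaxMonoidal

lemma unitIso_δ (A B : C) :
    ρ.unitIso.hom.app (A ⊗ B) ≫ δ (ρ.F 1) A B = ρ.unitIso.hom.app A ⊗ₘ ρ.unitIso.hom.app B := by
  have h1 := NatTrans.IsMonoidal.tensor (τ := ρ.unitIso.hom) A B
  rw [Functor.LaxMonoidal.id_μ] at h1
  have h2 := congrArg (fun f => f ≫ δ (ρ.F 1) A B) h1
  simp only [Category.assoc, Functor.Monoidal.μ_δ, Category.comp_id] at h2
  erw [Category.id_comp] at h2
  exact h2

variable [MonoidalPreadditive C] [MonoidalLinear k C]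

lemma smul_tensor_smul {X Y X' Y' : C} (r r' : k) (f : X ⟶ Y) (f' : X' ⟶ Y') :
    (r • f) ⊗ₘ (r' • f') = (r * r') • (f ⊗ₘ f') := by
  simp [MonoidalCategory.tensorHom_def, MonoidalLinear.smul_whiskerRight, MonoidalLinear.whiskerLeft_smul,
    smul_smul, mul_comm]

lemma tensor_family {g h x : G} (e : g * h = x) {A B : C} {ag : (ρ.F g).obj A ⟶ A}
    {ah : (ρ.F h).obj A ⟶ A} {ax : (ρ.F x).obj A ⟶ A} {bg : (ρ.F g).obj B ⟶ B}
    {bh : (ρ.F h).obj B ⟶ B} {bx : (ρ.F x).obj B ⟶ B} {r r' : k}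
    (ha : (ρ.F g).map ah ≫ ag = r • ((ρ.mulIso e).hom.app A ≫ ax))
    (hb : (ρ.F g).map bh ≫ bg = r' • ((ρ.mulIso e).hom.app B ≫ bx)) :
    (ρ.F g).map (δ (ρ.F h) A B ≫ (ah ⊗ₘ bh)) ≫ δ (ρ.F g) A B ≫ (ag ⊗ₘ bg) =
      (r * r') • ((ρ.mulIso e).hom.app (A ⊗ B) ≫ δ (ρ.F x) A B ≫ (ax ⊗ₘ bx)) := by
  have h1 := ρ.map_δ_comp e A B
  rw [Functor.map_comp, Category.assoc, ← δ_natural_assoc, tensorHom_comp_tensorHom, ha, hb,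
    smul_tensor_smul, Linear.comp_smul, Linear.comp_smul, ← tensorHom_comp_tensorHom,
    reassoc_of% h1]

/-- The tensor product of `C^G`: `(X, μ) ⊗ (X', μ') = (X ⊗ X', (μ^g ⊗ μ'^g) ∘ ρ_2^g)`, where
`ρ_2^g : ρ^g(X ⊗ X') → ρ^g(X) ⊗ ρ^g(X')` is the monoidal structure of `ρ^g`. -/
def tensor (A B : CatAction.EquivariantObject ρ.toCatAction) :
    CatAction.EquivariantObject ρ.toCatAction where
  X := A.X ⊗ B.X
  μ g := δ (ρ.F g) A.X B.X ≫ (A.μ g ⊗ₘ B.μ g)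
  map_mul g h := by
    have := ρ.tensor_family (r := 1) (r' := 1) (rfl : g * h = g * h)
      ((A.map_mul g h).trans (one_smul k _).symm) ((B.map_mul g h).trans (one_smul k _).symm)
    simpa using this
  map_one := by
    have := ρ.unitIso_δ A.X B.X
    rw [reassoc_of% this, tensorHom_comp_tensorHom, A.map_one, B.map_one]
    simp

/-- Let `c_U`, `c_A`, `c_B` be families of isomorphisms `ρ^g(U) ≅ U`, `ρ^g(A) ≅ A`, `ρ^g(B) ≅ B`
(`g ∈ T`) with factor sets `α_U`, `α_A`, `α_B`. The space `Hom(U, A ⊗ B)` is a projective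
representation of `T`, by `g · f = (c_A^g ⊗ c_B^g) ∘ ρ_2^g ∘ ρ^g(f) ∘ (c_U^g)⁻¹`, with factor set
`α_U α_A⁻¹ α_B⁻¹`. -/
def homRep {T : Subgroup G} {U A B : C} {cU : ∀ g : T, (ρ.F g).obj U ≅ U}
    {cA : ∀ g : T, (ρ.F g).obj A ≅ A} {cB : ∀ g : T, (ρ.F g).obj B ≅ B} {αU αA αB : T → T → kˣ}
    (hU : ρ.IsFactorSet cU αU) (hA : ρ.IsFactorSet cA αA) (hB : ρ.IsFactorSet cB αB) :
    ProjRep k (αU * αA⁻¹ * αB⁻¹) (U ⟶ A ⊗ B) where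
  toFun g :=
    { toFun f := (cU g).inv ≫ (ρ.F g).map f ≫ δ (ρ.F g) A B ≫ ((cA g).hom ⊗ₘ (cB g).hom)
      map_add' f f' := by simp [Functor.map_add]
      map_smul' r f := by simp [Functor.map_smul] }
  bijective g := by
    have e1 : IsIso (δ (ρ.F g) A B ≫ ((cA g).hom ⊗ₘ (cB g).hom)) := inferInstance
    constructor
    · intro f f' h
      have h' : (cU g).inv ≫ (ρ.F g).map f ≫ δ (ρ.F g) A B ≫ ((cA g).hom ⊗ₘ (cB g).hom) =
        (cU g).inv ≫ (ρ.F g).map f' ≫ δ (ρ.F g) A B ≫ ((cA g).hom ⊗ₘ (cB g).hom) := h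
      rw [cancel_epi, cancel_mono] at h'
      exact (ρ.F g).map_injective h'
    · intro f
      obtain ⟨f', hf'⟩ := (ρ.F g).map_surjective
        ((cU g).hom ≫ f ≫ inv (δ (ρ.F g) A B ≫ ((cA g).hom ⊗ₘ (cB g).hom)))
      refine ⟨f', ?_⟩
      change (cU g).inv ≫ (ρ.F g).map f' ≫ δ (ρ.F g) A B ≫ ((cA g).hom ⊗ₘ (cB g).hom) = f
      rw [hf', Category.assoc, Category.assoc, IsIso.inv_hom_id, Category.comp_id,
        Iso.inv_hom_id_assoc]
  map_mul g h f := by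
    have e : (g : G) * h = (g * h : T) := rfl
    have h1 := ρ.tensor_family e (hA.comp g h rfl) (hB.comp g h rfl)
    have h2 := hU.comp g h rfl
    have nat := (ρ.mulIso e).hom.naturality f
    rw [Functor.comp_map] at nat
    have h3 : (cU g).inv ≫ (ρ.F g).map (cU h).inv ≫ (ρ.mulIso e).hom.app U =
        (αU g h : k) • (cU (g * h)).inv := by
      rw [Iso.inv_comp_eq, ← cancel_epi ((ρ.F g).map (cU h).hom), ← Functor.map_comp_assoc,
        Iso.hom_inv_id, ← Category.assoc, Linear.comp_smul, h2]
      simp [smul_smul]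
    change (cU g).inv ≫ (ρ.F g).map ((cU h).inv ≫ (ρ.F h).map f ≫ δ (ρ.F h) A B ≫
      ((cA h).hom ⊗ₘ (cB h).hom)) ≫ δ (ρ.F g) A B ≫ ((cA g).hom ⊗ₘ (cB g).hom) =
      (((αU * αA⁻¹ * αB⁻¹) g h : kˣ) : k) • ((cU (g * h)).inv ≫ (ρ.F (g * h : T)).map f ≫
        δ (ρ.F (g * h : T)) A B ≫ ((cA (g * h)).hom ⊗ₘ (cB (g * h)).hom))
    rw [Functor.map_comp, Functor.map_comp, Category.assoc, Category.assoc, h1, Linear.comp_smul,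
      Linear.comp_smul, Linear.comp_smul, reassoc_of% nat, reassoc_of% h3, Linear.smul_comp,
      smul_smul]
    congr 1
    simp
    ring

end Tensor

section Fusion

variable [MonoidalPreadditive C] [MonoidalLinear k C] {U Y Z : C}

/-- The subgroup `T = G_U ∩ t G_Y t⁻¹ ∩ s G_Z s⁻¹`. -/
def stab (U Y Z : C) (t s : G) : Subgroup G :=
  ρ.inertia U ⊓ (MulAut.conj t • ρ.inertia Y) ⊓ (MulAut.conj s • ρ.inertia Z)

/-- The inclusion `T → G_U`. -/
def toU (U Y Z : C) (t s : G) : ρ.stab U Y Z t s →* ρ.inertia U :=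
  Subgroup.inclusion (inf_le_left.trans inf_le_left)

/-- The inclusion `T → t G_Y t⁻¹`. -/
def toY (U Y Z : C) (t s : G) : ρ.stab U Y Z t s →* ↥(MulAut.conj t • ρ.inertia Y) :=
  Subgroup.inclusion (inf_le_left.trans inf_le_right)

/-- The inclusion `T → s G_Z s⁻¹`. -/
def toZ (U Y Z : C) (t s : G) : ρ.stab U Y Z t s →* ↥(MulAut.conj s • ρ.inertia Z) :=
  Subgroup.inclusion inf_le_right

variable {cU : ∀ g : ρ.inertia U, (ρ.F g).obj U ≅ U} {cY : ∀ g : ρ.inertia Y, (ρ.F g).obj Y ≅ Y}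
  {cZ : ∀ g : ρ.inertia Z, (ρ.F g).obj Z ≅ Z}
  {αU : ρ.inertia U → ρ.inertia U → kˣ} {αY : ρ.inertia Y → ρ.inertia Y → kˣ}
  {αZ : ρ.inertia Z → ρ.inertia Z → kˣ}

/-- The projective representation `τ_U^{t,s}(Y, Z) = Hom(U, ρ^t(Y) ⊗ ρ^s(Z))` of
`T = G_U ∩ t G_Y t⁻¹ ∩ s G_Z s⁻¹`, formed with the families `c_U`, `ᵗc_Y`, `ˢc_Z`. -/
def tau (hU : ρ.IsFactorSet cU αU) (hY : ρ.IsFactorSet cY αY) (hZ : ρ.IsFactorSet cZ αZ)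
    (t s : G) :
    ProjRep k
      ((fun g h : ρ.stab U Y Z t s => αU (ρ.toU U Y Z t s g) (ρ.toU U Y Z t s h)) *
        (fun g h => αY (CatAction.conjHom t _ (ρ.toY U Y Z t s g))
          (CatAction.conjHom t _ (ρ.toY U Y Z t s h)))⁻¹ *
        (fun g h => αZ (CatAction.conjHom s _ (ρ.toZ U Y Z t s g))
          (CatAction.conjHom s _ (ρ.toZ U Y Z t s h)))⁻¹)
      (U ⟶ (ρ.F t).obj Y ⊗ (ρ.F s).obj Z) :=
  ρ.homRep (hU.restrict (T := ρ.stab U Y Z t s) (inf_le_left.trans inf_le_left))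
    ((hY.conj t).restrict (T := ρ.stab U Y Z t s) (inf_le_left.trans inf_le_right))
    ((hZ.conj s).restrict (T := ρ.stab U Y Z t s) inf_le_right)

variable {Vδ Vπ Vγ : Type*} [AddCommGroup Vδ] [Module k Vδ] [AddCommGroup Vπ] [Module k Vπ]
  [AddCommGroup Vγ] [Module k Vγ]

/-- The projective representation `ᵗπ|_T ⊗ ˢγ|_T ⊗ τ_U^{t,s}(Y, Z)` of `T`. Its factor set is
`α_U|_T`, those of the first two tensor factors cancelling. -/
noncomputable def productRep (hU : ρ.IsFactorSet cU αU) (hY : ρ.IsFactorSet cY αY)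
    (hZ : ρ.IsFactorSet cZ αZ) (π : ProjRep k αY Vπ) (γ : ProjRep k αZ Vγ) (t s : G) :
    ProjRep k (fun g h : ρ.stab U Y Z t s => αU (ρ.toU U Y Z t s g) (ρ.toU U Y Z t s h))
      (TensorProduct k (TensorProduct k Vπ Vγ) (U ⟶ (ρ.F t).obj Y ⊗ (ρ.F s).obj Z)) :=
  ((((π.comap (CatAction.conjHom t (ρ.inertia Y))).comap (ρ.toY U Y Z t s)).tensor
    ((γ.comap (CatAction.conjHom s (ρ.inertia Z))).comap (ρ.toZ U Y Z t s))).tensor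
      (ρ.tau hU hY hZ t s)).ofEq (by
    funext g h
    apply Units.ext
    simp [toU, toY, toZ]
    field_simp)

end Fusion

end TensorAction

end Equivariantization

/-! The formula is Frobenius reciprocity followed by a Mackey decomposition.

Since S_{U,δ} is the induced object L(V_δ ⊗ U), a morphism of C^G from it to any B is determined by
its restriction to V_δ ⊗ U, and every G_U-equivariant morphism V_δ ⊗ U → B extends
(`induceHomEquiv`). By linearity in V_δ such a morphism is an intertwiner from δ to Hom(U, B), on
which G_U acts projectively with factor set α_U (`finrank_homs_ofProjRep`). The multiplicity is
therefore an intertwining number over G_U.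

Take B = S_{Y,π} ⊗ S_{Z,γ}. It is the direct sum, over pairs of cosets in G/G_Y × G/G_Z, of products
of summands, and the structure maps permute these blocks as G_U permutes the pairs. So Hom(U, B)
carries a system of imprimitivity, and an intertwiner into it amounts to one intertwiner for each
orbit, over the stabilizer of a representative and into the corresponding block
(`ProjRep.mult_eq_sum`). The stabilizer of (t, s) is T = G_U ∩ tG_Yt⁻¹ ∩ sG_Zs⁻¹
(`smul_pair_eq_iff`). The block is V_π ⊗ V_γ ⊗ Hom(U, ρ^tY ⊗ ρ^sZ) (`pairRetraction_pairEmb`,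
`pairEmb_pairRetraction`), with T acting by ᵗπ ⊗ ˢγ ⊗ τ (`tensorHomRep_pairEmb`).

This gives one term per orbit. Sorting the orbits by the double coset of t⁻¹s and dropping those
with zero Hom space, whose terms vanish, gives the stated double sum. -/

namespace Equivariantization

/-! ### Averaging and the Mackey decomposition of intertwiners. -/

namespace ProjRep

variable {k : Type*} [Field k] {G : Type*} [Group G] {α : G → G → kˣ} {V W : Type*}
  [AddCommGroup V] [Module k V] [AddCommGroup W] [Module k W]

/-- The operator of a group element as a linear automorphism. -/
noncomputable def equiv (π : ProjRep k α V) (g : G) : V ≃ₗ[k] V :=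
  LinearEquiv.ofBijective (π.toFun g) (π.bijective g)

lemma equiv_apply (π : ProjRep k α V) (g : G) (v : V) : π.equiv g v = π.toFun g v := rfl

/-- The conjugate `W(g) φ V(g)⁻¹` of a linear map `φ`. -/
noncomputable def conjMap (D : ProjRep k α V) (A : ProjRep k α W) (g : G) :
    (V →ₗ[k] W) →ₗ[k] (V →ₗ[k] W) :=
  ((D.equiv g).arrowCongr (A.equiv g)).toLinearMap

lemma conjMap_apply (D : ProjRep k α V) (A : ProjRep k α W) (g : G) (φ : V →ₗ[k] W) (v : V) :
    conjMap D A g φ v = A.toFun g (φ ((D.equiv g).symm v)) := rfl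

/-- The scalar α(g, h) from the target cancels its inverse from the source, because both
representations have the same factor set. Conjugation is thus a genuine linear action, whose
invariants are the intertwiners; this is what makes averaging available. -/
lemma conjMap_conjMap (D : ProjRep k α V) (A : ProjRep k α W) (g h : G) (φ : V →ₗ[k] W) :
    conjMap D A g (conjMap D A h φ) = conjMap D A (g * h) φ := by
  ext v
  obtain ⟨u, rfl⟩ := (D.bijective (g * h)).2 v
  have e : D.toFun g (D.toFun h (((α g h)⁻¹ : kˣ) • u)) = D.toFun (g * h) u := by
    rw [D.map_mul, Units.smul_def, _root_.map_smul, smul_smul]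
    simp
  have e1 : (D.equiv h).symm ((D.equiv g).symm (D.toFun (g * h) u)) =
      ((α g h)⁻¹ : kˣ) • u := by
    rw [LinearEquiv.symm_apply_eq, LinearEquiv.symm_apply_eq]
    exact e.symm
  have e2 : (D.equiv (g * h)).symm (D.toFun (g * h) u) = u :=
    (D.equiv (g * h)).symm_apply_apply u
  rw [conjMap_apply, conjMap_apply, conjMap_apply, e1, e2, A.map_mul, Units.smul_def,
    _root_.map_smul, _root_.map_smul, smul_smul]
  simp

lemma mem_intertwiners_iff_conjMap {D : ProjRep k α V} {A : ProjRep k α W} {φ : V →ₗ[k] W} :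
    φ ∈ intertwiners D A ↔ ∀ g, conjMap D A g φ = φ := by
  constructor
  · intro h g
    ext v
    rw [conjMap_apply, ← h g, ← equiv_apply, LinearEquiv.apply_symm_apply]
  · intro h g v
    have := LinearMap.congr_fun (h g) (D.toFun g v)
    rw [conjMap_apply, ← equiv_apply D, LinearEquiv.symm_apply_apply] at this
    exact this.symm

lemma sum_conjMap_mem_intertwiners [Fintype G] (D : ProjRep k α V) (A : ProjRep k α W)
    (φ : V →ₗ[k] W) : ∑ g, conjMap D A g φ ∈ intertwiners D A := by
  rw [mem_intertwiners_iff_conjMap]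
  intro h
  rw [map_sum]
  simp only [conjMap_conjMap]
  exact Fintype.sum_equiv (Equiv.mulLeft h) _ _ fun g => rfl

/-- **Mackey decomposition of intertwiners.** Let `W` be a projective representation of `G` with a
system of imprimitivity `(E x)`, indexed by a `G`-set `X`. Let `x i` represent the orbits of `X`,
let `T i` be the stabilizer of `x i` and `W' i` the image of `E (x i)`. An intertwiner to `W` is the
same as a family of intertwiners, over `T i`, to `W' i`. -/
theorem mult_eq_sum [CharZero k] [Finite G] {X : Type*} [MulAction G X] [Fintype X]
    [FiniteDimensional k V] (D : ProjRep k α V) (A : ProjRep k α W) (E : X → W →ₗ[k] W)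
    (hsum : ∀ w, ∑ x, E x w = w) (horth : ∀ x y, x ≠ y → ∀ w, E x (E y w) = 0)
    (hE : ∀ g x w, A.toFun g (E x w) = E (g • x) (A.toFun g w))
    {ι : Type*} [Fintype ι] (x : ι → X)
    (hx : Function.Bijective fun i => (Quotient.mk _ (x i) : MulAction.orbitRel.Quotient G X))
    {T : ι → Type*} [∀ i, Group (T i)] (f : ∀ i, T i →* G)
    (hf : ∀ i, Function.Injective (f i)) (hT : ∀ i g, g • x i = x i ↔ ∃ a, f i a = g)
    {W' : ι → Type*} [∀ i, AddCommGroup (W' i)] [∀ i, Module k (W' i)]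
    [∀ i, FiniteDimensional k (W' i)]
    (B : ∀ i, ProjRep k (fun a b => α (f i a) (f i b)) (W' i))
    (Ψ : ∀ i, W' i →ₗ[k] W) (R : ∀ i, W →ₗ[k] W' i)
    (hRΨ : ∀ i w, R i (Ψ i w) = w) (hΨR : ∀ i w, Ψ i (R i w) = E (x i) w)
    (hB : ∀ i a w, A.toFun (f i a) (Ψ i w) = Ψ i ((B i).toFun a w)) :
    mult D A = ∑ i, mult (D.comap (f i)) (B i) := by
  classical
  cases nonempty_fintype G
  have (i : ι) : Finite (T i) := Finite.of_injective _ (hf i)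
  have (i : ι) : Fintype (T i) := Fintype.ofFinite _
  have hRE : ∀ i w, R i (E (x i) w) = R i w := fun i w => by rw [← hΨR, hRΨ]
  have hEΨ : ∀ i w, E (x i) (Ψ i w) = Ψ i w := fun i w => by rw [← hΨR, hRΨ]
  have hR0 : ∀ i y w, y ≠ x i → R i (E y w) = 0 := fun i y w h => by
    rw [← hRE, horth _ _ h.symm, map_zero]
  -- Equivariance of `Ψ i` passes to `R i` because `f i a` fixes `x i`, so that A(f i a) commutes
  -- with the projection `E (x i)`.
  have hRA : ∀ i a w, R i (A.toFun (f i a) w) = (B i).toFun a (R i w) := by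
    intro i a w
    have e : f i a • x i = x i := (hT i _).2 ⟨a, rfl⟩
    rw [← hRE]
    nth_rw 1 [← e]
    rw [← hE, ← hΨR, hB, hRΨ]
  let F : intertwiners D A →ₗ[k] ∀ i, intertwiners (D.comap (f i)) (B i) :=
    LinearMap.pi fun i =>
      (((R i).compRight k).comp (intertwiners D A).subtype).codRestrict _ fun φ a v => by
        change R i (φ.1 (D.toFun (f i a) v)) = (B i).toFun a (R i (φ.1 v))
        rw [φ.2, hRA]
  have hF : ∀ φ i v, (F φ i).1 v = R i (φ.1 v) := fun _ _ _ => rfl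
  -- An intertwiner is determined by its components at the orbit representatives: its component at g
  -- • x i on the vector D(g)u is A(g) applied to its component at x i on u.
  have inj : Function.Injective F := by
    rw [← LinearMap.ker_eq_bot, LinearMap.ker_eq_bot']
    intro φ h
    apply Subtype.ext
    ext v
    rw [← hsum (φ.1 v)]
    apply Finset.sum_eq_zero
    intro y _
    obtain ⟨i, hi⟩ := hx.2 (Quotient.mk _ y)
    obtain ⟨g, hg⟩ : y ∈ MulAction.orbit G (x i) :=
      MulAction.orbitRel_apply.1 (Quotient.exact hi.symm)
    obtain ⟨u, rfl⟩ := (D.bijective g).2 v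
    have h0 : R i (φ.1 u) = 0 := by rw [← hF, h]; rfl
    rw [φ.2, ← hg]
    change E (g • x i) _ = 0
    rw [← hE, ← hΨR, h0, map_zero, map_zero]
  have surj : Function.Surjective F := by
    intro φ
    -- In the sum over G, only the g with g • x i = x j survive `R j`. There are none unless i = j,
    -- since distinct representatives lie in distinct orbits; for i = j they form the image of `T
    -- i`, and each contributes `φ i` because `φ i` is already `T i`-equivariant.
    have key : ∀ i j, ∀ v, R j ((∑ g, conjMap D A g (Ψ i ∘ₗ (φ i).1)) v) =
        if h : i = j then (Fintype.card (T j) : k) • (φ j).1 v else 0 := by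
      intro i j v
      have move : ∀ g w, R j (A.toFun g (Ψ i w)) = if g • x i = x j then
          R j (A.toFun g (Ψ i w)) else 0 := by
        intro g w
        split_ifs with h
        · rfl
        · rw [← hEΨ, hE, hR0 _ _ _ h]
      rw [LinearMap.sum_apply, map_sum]
      simp only [conjMap_apply, LinearMap.comp_apply]
      split_ifs with h
      · subst h
        rw [Finset.sum_congr rfl fun g _ => move g _, ← Finset.sum_filter]
        have himg : (Finset.univ.filter fun g : G => g • x i = x i) =
            Finset.univ.image (f i) := by
          ext g
          simp [hT]
        rw [himg, Finset.sum_image fun a _ b _ h => hf i h]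
        rw [Finset.sum_congr rfl (g := fun _ => (φ i).1 v)]
        · simp [Nat.cast_smul_eq_nsmul]
        · intro a _
          rw [hRA, hRΨ]
          have e := (φ i).2 a ((D.equiv (f i a)).symm v)
          rw [← e]
          exact congrArg _ ((D.equiv (f i a)).apply_symm_apply v)
      · apply Finset.sum_eq_zero
        intro g _
        rw [move, if_neg]
        intro e
        apply h
        apply hx.1
        apply Quotient.sound
        exact MulAction.orbitRel_apply.2 ⟨g⁻¹, by simp [← e]⟩
    -- The weight is 1/|T i| rather than 1/|G|, by the count in `key`; it exists in characteristic
    -- zero.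
    refine ⟨∑ i, (Fintype.card (T i) : k)⁻¹ •
      ⟨_, sum_conjMap_mem_intertwiners D A (Ψ i ∘ₗ (φ i).1)⟩, ?_⟩
    funext j
    apply Subtype.ext
    ext v
    rw [hF, AddSubmonoidClass.coe_finsetSum, LinearMap.sum_apply, map_sum,
      Finset.sum_eq_single j]
    · rw [SetLike.val_smul, LinearMap.smul_apply, _root_.map_smul, key, dif_pos rfl, smul_smul,
        inv_mul_cancel₀ (Nat.cast_ne_zero.2 Fintype.card_ne_zero), one_smul]
    · intro i _ hij
      rw [SetLike.val_smul, LinearMap.smul_apply, _root_.map_smul, key, dif_neg hij, smul_zero]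
    · simp
  rw [mult, (LinearEquiv.ofBijective F ⟨inj, surj⟩).finrank_eq, Module.finrank_pi_fintype]
  rfl

end ProjRep

/-! ### Induction from C^H to C^G and Frobenius reciprocity. -/

namespace CatAction

variable {k : Type*} [Field k] {G : Type*} [Group G] {C : Type*} [Category* C] [Abelian C]
  [Linear k C] {ρ : CatAction k G C} {H : Subgroup G}

namespace EquivariantObject

/-- Restriction of an equivariant object to a subgroup. -/
def res (B : EquivariantObject ρ) (H : Subgroup G) : EquivariantObject (ρ.restrict H) where
  X := B.X
  μ g := B.μ g
  map_mul g h := B.map_mul g h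
  map_one := B.map_one

/-- The structure map of an equivariant object as an isomorphism. -/
noncomputable def iso (B : EquivariantObject ρ) (g : G) : (ρ.F g).obj B.X ≅ B.X :=
  haveI := B.isIso_μ g
  asIso (B.μ g)

@[simp] lemma iso_hom (B : EquivariantObject ρ) (g : G) : (B.iso g).hom = B.μ g := rfl

end EquivariantObject

section Induction

/-- The structure map of an object of `C^H`, written with the functors of the action of `G`. -/
def subgroupMap (N : EquivariantObject (ρ.restrict H)) {h : G} (hh : h ∈ H) :
    (ρ.F h).obj N.X ⟶ N.X :=
  N.μ ⟨h, hh⟩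

lemma subgroupMap_mul (N : EquivariantObject (ρ.restrict H)) {g h x : G} (hg : g ∈ H) (hh : h ∈ H)
    (hx : x ∈ H) (e : g * h = x) :
    (ρ.F g).map (subgroupMap N hh) ≫ subgroupMap N hg =
      (ρ.mulIso e).hom.app N.X ≫ subgroupMap N hx :=
  N.map_mul' (g := ⟨g, hg⟩) (h := ⟨h, hh⟩) (x := ⟨x, hx⟩) (Subtype.ext e)

/-- The representative of the trivial coset need not be 1. It lies in H, so the structure map of N
identifies the summand of the trivial coset with N; hence the role of `baseIso` below. -/
lemma section_one_mem (σ : G ⧸ H → G) (hσ : ∀ q, (σ q : G ⧸ H) = q) :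
    σ ((1 : G) : G ⧸ H) ∈ H := by
  have := QuotientGroup.eq.1 (hσ ((1 : G) : G ⧸ H))
  simpa using this

variable (N : EquivariantObject (ρ.restrict H)) (σ : G ⧸ H → G)
  (hσ : ∀ q, (σ q : G ⧸ H) = q)

/-- The structure map of `N` at the representative of the trivial coset. -/
noncomputable def baseIso : (ρ.F (σ ((1 : G) : G ⧸ H))).obj N.X ≅ N.X :=
  N.iso ⟨_, section_one_mem σ hσ⟩

lemma baseIso_hom : (baseIso N σ hσ).hom = subgroupMap N (section_one_mem σ hσ) := rfl

variable [Finite (G ⧸ H)]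

/-- The inclusion of the summand of a coset into `L(N)`. -/
noncomputable def induceι (q : G ⧸ H) : (ρ.F (σ q)).obj N.X ⟶ (induce N σ hσ).X :=
  biproduct.ι (fun q : G ⧸ H => (ρ.F (σ q)).obj N.X) q

/-- The projection of `L(N)` onto the summand of a coset. -/
noncomputable def induceπ (q : G ⧸ H) : (induce N σ hσ).X ⟶ (ρ.F (σ q)).obj N.X :=
  biproduct.π (fun q : G ⧸ H => (ρ.F (σ q)).obj N.X) q

@[simp]
lemma induceι_π_self (q : G ⧸ H) : induceι N σ hσ q ≫ induceπ N σ hσ q = 𝟙 _ :=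
  biproduct.ι_π_self _ _

@[simp]
lemma induceι_π_self_assoc (q : G ⧸ H) {W : C} (f : (ρ.F (σ q)).obj N.X ⟶ W) :
    induceι N σ hσ q ≫ induceπ N σ hσ q ≫ f = f := by
  rw [← Category.assoc, induceι_π_self, Category.id_comp]

lemma induceι_π_ne {q q' : G ⧸ H} (h : q ≠ q') : induceι N σ hσ q ≫ induceπ N σ hσ q' = 0 :=
  biproduct.ι_π_ne _ h

lemma induceι_π_ne_assoc {q q' : G ⧸ H} (h : q ≠ q') {W : C} (f : (ρ.F (σ q')).obj N.X ⟶ W) :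
    induceι N σ hσ q ≫ induceπ N σ hσ q' ≫ f = 0 := by
  rw [← Category.assoc, induceι_π_ne N σ hσ h, zero_comp]

lemma induce_hom_ext (F : C ⥤ C) [F.Additive] {W : C} {a b : F.obj (induce N σ hσ).X ⟶ W}
    (h : ∀ q, F.map (induceι N σ hσ q) ≫ a = F.map (induceι N σ hσ q) ≫ b) : a = b :=
  map_biproduct_hom_ext F (fun q : G ⧸ H => (ρ.F (σ q)).obj N.X) h

lemma map_induceι_μ (g : G) (q q' : G ⧸ H) (hq : g • q = q') {h : G} (hh : h ∈ H)
    (e : σ q' * h = g * σ q) :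
    (ρ.F g).map (induceι N σ hσ q) ≫ (induce N σ hσ).μ g =
      ρ.cell e (subgroupMap N hh) ≫ induceι N σ hσ q' :=
  map_ι_induceMap N σ hσ g q q' hq ⟨h, hh⟩ e

/-- The unit `N → L(N)` of the induction. -/
noncomputable def induceUnit : N.X ⟶ (induce N σ hσ).X :=
  (baseIso N σ hσ).inv ≫ induceι N σ hσ ((1 : G) : G ⧸ H)

/-- The retraction `L(N) → N` of the unit of the induction. -/
noncomputable def induceRetraction : (induce N σ hσ).X ⟶ N.X :=
  induceπ N σ hσ ((1 : G) : G ⧸ H) ≫ (baseIso N σ hσ).hom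

/-- The projection of `L(N)` to the summand of a coset. -/
noncomputable def cosetProj (q : G ⧸ H) : (induce N σ hσ).X ⟶ (induce N σ hσ).X :=
  induceπ N σ hσ q ≫ induceι N σ hσ q

lemma induceUnit_retraction : induceUnit N σ hσ ≫ induceRetraction N σ hσ = 𝟙 _ := by
  simp [induceUnit, induceRetraction]

lemma induceRetraction_unit :
    induceRetraction N σ hσ ≫ induceUnit N σ hσ = cosetProj N σ hσ ((1 : G) : G ⧸ H) := by
  simp [induceUnit, induceRetraction, cosetProj]

lemma cosetProj_comp_of_ne {q q' : G ⧸ H} (h : q ≠ q') :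
    cosetProj N σ hσ q ≫ cosetProj N σ hσ q' = 0 := by
  simp [cosetProj, induceι_π_ne_assoc _ _ _ h]

lemma sum_cosetProj [Fintype (G ⧸ H)] : ∑ q, cosetProj N σ hσ q = 𝟙 _ :=
  IsBilimit.total (biproduct.isBilimit fun q : G ⧸ H => (ρ.F (σ q)).obj N.X)

/-- The source of the imprimitivity: μ^g carries the summand of q to that of g • q, so it
intertwines the corresponding projections. -/
lemma map_cosetProj (g : G) (q : G ⧸ H) :
    (ρ.F g).map (cosetProj N σ hσ q) ≫ (induce N σ hσ).μ g =
      (induce N σ hσ).μ g ≫ cosetProj N σ hσ (g • q) := by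
  apply induce_hom_ext
  intro q'
  have h1 := map_induceι_μ N σ hσ g q' (g • q') rfl (section_rel σ hσ g q')
      (mul_inv_cancel_left _ _)
  rw [reassoc_of% h1, ← Functor.map_comp_assoc]
  by_cases h : q' = q
  · subst h
    simp only [cosetProj, induceι_π_self_assoc]
    rw [h1]
  · have h' : g • q' ≠ g • q := fun e => h (MulAction.injective g e)
    simp only [cosetProj, induceι_π_ne_assoc _ _ _ h, induceι_π_ne_assoc _ _ _ h', zero_comp,
      Functor.map_zero, comp_zero]

/-- The copy of N at the trivial coset generates L(N): its translate by σ q is exactly the summand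
of q. The relevant element of H is σ(1), so the cell reduces to ρ^{σ q} of the base isomorphism and
cancels the inverse built into the unit. -/
lemma map_induceUnit_section (q : G ⧸ H) :
    (ρ.F (σ q)).map (induceUnit N σ hσ) ≫ (induce N σ hσ).μ (σ q) = induceι N σ hσ q := by
  have hq : σ q • ((1 : G) : G ⧸ H) = q := by
    rw [MulAction.Quotient.smul_coe, smul_eq_mul, mul_one, hσ]
  have h1 := map_induceι_μ N σ hσ (σ q) ((1 : G) : G ⧸ H) q hq (section_one_mem σ hσ) rfl
  have h2 : ρ.cell (b := σ q) (g := σ q) (a := σ ((1 : G) : G ⧸ H)) rfl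
      (subgroupMap N (section_one_mem σ hσ)) = (ρ.F (σ q)).map (baseIso N σ hσ).hom := by
    unfold cell
    exact Iso.hom_inv_id_app_assoc _ _ _
  rw [induceUnit, Functor.map_comp, Category.assoc, h1, h2, ← Functor.map_comp_assoc,
    Iso.inv_hom_id, CategoryTheory.Functor.map_id, Category.id_comp]

/-- The unit `N → L(N)` is a morphism of `C^H`. -/
lemma μ_induceUnit {h : G} (hh : h ∈ H) :
    subgroupMap N hh ≫ induceUnit N σ hσ =
      (ρ.F h).map (induceUnit N σ hσ) ≫ (induce N σ hσ).μ h := by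
  have hq : h • ((1 : G) : G ⧸ H) = ((1 : G) : G ⧸ H) := by
    rw [MulAction.Quotient.smul_coe, QuotientGroup.eq]
    simpa using hh
  have h₀ := section_one_mem σ hσ
  have e := mul_inv_cancel_left (σ ((1 : G) : G ⧸ H)) (h * σ ((1 : G) : G ⧸ H))
  have hx := H.mul_mem (H.inv_mem h₀) (H.mul_mem hh h₀)
  have h1 := map_induceι_μ N σ hσ h ((1 : G) : G ⧸ H) _ hq hx e
  -- Both sides are ρ_2 followed by the structure map of N at h σ(1), factored as h · σ(1) on one
  -- side and as σ(1) · (σ(1)⁻¹ h σ(1)) on the other.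
  have m : ρ.cell e (subgroupMap N hx) ≫ (baseIso N σ hσ).hom =
      (ρ.F h).map (baseIso N σ hσ).hom ≫ subgroupMap N hh := by
    rw [baseIso_hom, subgroupMap_mul N hh h₀ (H.mul_mem hh h₀) rfl]
    unfold cell
    rw [Category.assoc, Category.assoc, subgroupMap_mul N h₀ hx (H.mul_mem hh h₀) e,
      Iso.inv_hom_id_app_assoc]
  rw [← Iso.eq_comp_inv, Category.assoc] at m
  rw [induceUnit, Functor.map_comp, Category.assoc, h1, m, Category.assoc, Category.assoc,
    ← Functor.map_comp_assoc, Iso.inv_hom_id, CategoryTheory.Functor.map_id, Category.id_comp]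

lemma induce_hom_exists {W : C} (f : ∀ q, (ρ.F (σ q)).obj N.X ⟶ W) :
    ∃ φ : (induce N σ hσ).X ⟶ W, ∀ q, induceι N σ hσ q ≫ φ = f q :=
  ⟨biproduct.desc f, fun _ => biproduct.ι_desc _ _⟩

/-- **Frobenius reciprocity**: `Hom(L(N), B) = Hom(N, B|_H)`. -/
noncomputable def induceHomEquiv (B : EquivariantObject ρ) :
    (induce N σ hσ ⟶ B) ≃ₗ[k] N.homs (B.res H) :=
  let F : (induce N σ hσ).homs B →ₗ[k] N.homs (B.res H) :=
    ((Linear.leftComp k B.X (induceUnit N σ hσ)).comp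
      ((induce N σ hσ).homs B).subtype).codRestrict _ fun φ h => by
        change subgroupMap N h.2 ≫ induceUnit N σ hσ ≫ φ.1 =
          (ρ.F (h : G)).map (induceUnit N σ hσ ≫ φ.1) ≫ B.μ h
        rw [← Category.assoc, μ_induceUnit, Category.assoc, φ.2, Functor.map_comp, Category.assoc]
  LinearEquiv.ofBijective F (by
    have hF : ∀ φ, (F φ).1 = induceUnit N σ hσ ≫ φ.1 := fun _ => rfl
    constructor
    · rw [← LinearMap.ker_eq_bot, LinearMap.ker_eq_bot']
      intro φ h
      have h0 : induceUnit N σ hσ ≫ φ.1 = 0 := by rw [← hF, h]; rfl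
      apply Subtype.ext
      apply induce_hom_ext N σ hσ (𝟭 C)
      intro q
      change induceι N σ hσ q ≫ φ.1 = induceι N σ hσ q ≫ 0
      rw [← map_induceUnit_section N σ hσ q, Category.assoc, φ.2, ← Functor.map_comp_assoc, h0]
      simp
    · rintro ⟨f, hf'⟩
      change N.X ⟶ B.X at f
      have hf : ∀ {h : G} (hh : h ∈ H), subgroupMap N hh ≫ f = (ρ.F h).map f ≫ B.μ h :=
        fun hh => hf' ⟨_, hh⟩
      -- The only possible extension of f, since the summand of q is the translate of N by σ q.
      obtain ⟨φ, hφ⟩ := induce_hom_exists N σ hσ fun q => (ρ.F (σ q)).map f ≫ B.μ (σ q)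
      refine ⟨⟨φ, fun g => ?_⟩, ?_⟩
      · apply induce_hom_ext N σ hσ
        intro q
        have h1 := map_induceι_μ N σ hσ g q (g • q) rfl (section_rel σ hσ g q)
          (mul_inv_cancel_left _ _)
        rw [reassoc_of% h1, ← Functor.map_comp_assoc, hφ, hφ, Functor.map_comp, Category.assoc,
          B.map_mul]
        unfold cell
        -- With h = σ(gq)⁻¹ g σ(q), equivariance of f at h and naturality of ρ_2 bring both sides to
        -- ρ_2^{g,σ q}, then ρ^{gσ(q)}(f), then μ^{gσ(q)}.
        simp only [Category.assoc]
        have hz := B.map_mul' (mul_inv_cancel_left (σ (g • q)) (g * σ q))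
        have n1 := (ρ.mulIso (rfl : g * σ q = g * σ q)).hom.naturality f
        have n2 := (ρ.mulIso (mul_inv_cancel_left (σ (g • q)) (g * σ q))).inv.naturality f
        rw [Functor.comp_map] at n1 n2
        rw [← Functor.map_comp_assoc, hf, Functor.map_comp, Category.assoc, hz, reassoc_of% n1,
          ← reassoc_of% n2]
        erw [Iso.inv_hom_id_app_assoc]
      · apply Subtype.ext
        change induceUnit N σ hσ ≫ φ = f
        rw [induceUnit, Category.assoc, hφ, Iso.inv_comp_eq, baseIso_hom]
        exact (hf (section_one_mem σ hσ)).symm)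

end Induction

end CatAction

/-! ### Morphisms out of V ⊗ U as intertwiners into Hom(U, B). -/

namespace CatAction

variable {k : Type*} [Field k] {G : Type*} [Group G] {C : Type*} [Category* C] [Abelian C]
  [Linear k C] {ρ : CatAction k G C}

section HomRep

variable {H : Subgroup G} {U : C} {cU : ∀ g : H, (ρ.F g).obj U ≅ U} {αU : H → H → kˣ}

/-- For an equivariant object `B`, the projective representation of `H` on `Hom(U, B)`, by
`g · f = μ^g ∘ ρ^g(f) ∘ (c_U^g)⁻¹`. -/
noncomputable def equivariantHomRep (hU : ρ.IsFactorSet cU αU) (B : EquivariantObject ρ) :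
    ProjRep k αU (U ⟶ B.X) where
  toFun g :=
    { toFun f := (cU g).inv ≫ (ρ.F g).map f ≫ B.μ g
      map_add' f f' := by simp [Functor.map_add]
      map_smul' r f := by simp [Functor.map_smul] }
  bijective g := by
    have := B.isIso_μ g
    constructor
    · intro f f' h
      change (cU g).inv ≫ (ρ.F g).map f ≫ B.μ g = (cU g).inv ≫ (ρ.F g).map f' ≫ B.μ g at h
      rw [cancel_epi, cancel_mono] at h
      exact (ρ.F g).map_injective h
    · intro f
      obtain ⟨f', hf'⟩ := (ρ.F g).map_surjective ((cU g).hom ≫ f ≫ inv (B.μ g))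
      refine ⟨f', ?_⟩
      change (cU g).inv ≫ (ρ.F g).map f' ≫ B.μ g = f
      simp [hf']
  map_mul g h f := by
    have e : (g : G) * h = (g * h : H) := rfl
    have h2 := hU.comp g h rfl
    have nat := (ρ.mulIso e).hom.naturality f
    rw [Functor.comp_map] at nat
    -- Composites of the c^g carry α_U⁻¹, so composites of their inverses carry α_U. The structure
    -- maps of B contribute no scalar, which leaves α_U as the factor set.
    have h3 : (cU g).inv ≫ (ρ.F g).map (cU h).inv ≫ (ρ.mulIso e).hom.app U =
        (αU g h : k) • (cU (g * h)).inv := by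
      rw [Iso.inv_comp_eq, ← cancel_epi ((ρ.F g).map (cU h).hom), ← Functor.map_comp_assoc,
        Iso.hom_inv_id, ← Category.assoc, Linear.comp_smul, h2]
      simp [smul_smul]
    change (cU g).inv ≫ (ρ.F g).map ((cU h).inv ≫ (ρ.F h).map f ≫ B.μ h) ≫ B.μ g =
      (αU g h : k) • ((cU (g * h)).inv ≫ (ρ.F (g * h : H)).map f ≫ B.μ (g * h : H))
    rw [Functor.map_comp, Functor.map_comp, Category.assoc, Category.assoc, B.map_mul' e,
      reassoc_of% nat, reassoc_of% h3, Linear.smul_comp]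

variable {V : Type*} [AddCommGroup V] [Module k V] [FiniteDimensional k V]

/-- Morphisms `V ⊗ U → W` are linear maps `V → Hom(U, W)`. -/
noncomputable def copowerHomEquiv (V : Type*) [AddCommGroup V] [Module k V]
    [FiniteDimensional k V] (U W : C) : (copower k V U ⟶ W) ≃ₗ[k] (V →ₗ[k] (U ⟶ W)) :=
  LinearEquiv.ofBijective
    { toFun φ := (Linear.rightComp k U φ).comp (ins V U)
      map_add' φ φ' := by ext v; simp
      map_smul' r φ := by ext v; simp }
    (by
      constructor
      · intro φ φ' h
        exact copower_hom_ext (k := k) (𝟭 C) fun v => LinearMap.congr_fun h v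
      · intro f
        refine ⟨biproduct.desc fun i => f (Module.finBasis k V i), ?_⟩
        apply (Module.finBasis k V).ext
        intro i
        change ins V U _ ≫ biproduct.desc _ = _
        rw [ins_basis]
        exact biproduct.ι_desc _ _)

/-- `Hom_{C^H}(V ⊗ U, B|_H)` is the space of intertwiners from `V` to `Hom(U, B)`. -/
lemma finrank_homs_ofProjRep (hU : ρ.IsFactorSet cU αU) (δ : ProjRep k αU V)
    (B : EquivariantObject ρ) :
    Module.finrank k ((ofProjRep hU δ).homs (B.res H)) = δ.mult (equivariantHomRep hU B) := by
  refine LinearEquiv.finrank_eq (LinearEquiv.ofSubmodules (copowerHomEquiv V U B.X) _ _ ?_)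
  ext φ
  refine (Submodule.mem_map_equiv (e := copowerHomEquiv V U B.X) _).trans ?_
  obtain ⟨φ, rfl⟩ := (copowerHomEquiv V U B.X).surjective φ
  rw [LinearEquiv.symm_apply_apply]
  change (∀ g : H, copowerMap (ρ := ρ) (g := g) (δ.toFun g) (cU g).hom ≫ φ =
      (ρ.F g).map φ ≫ B.μ g) ↔ ∀ (g : H) (v : V), ins V U (δ.toFun g v) ≫ φ =
        (cU g).inv ≫ (ρ.F g).map (ins V U v ≫ φ) ≫ B.μ g
  -- The two conditions agree one g at a time, since a morphism out of ρ^g(V ⊗ U) is determined by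
  -- its restrictions along the vectors of V.
  refine forall_congr' fun g => ?_
  have key (v : V) : (ρ.F g).map (ins V U v) ≫ copowerMap (δ.toFun g) (cU g).hom ≫ φ =
      (cU g).hom ≫ ins V U (δ.toFun g v) ≫ φ := by
    have := map_ins_copowerMap (ρ := ρ) (g := g) (δ.toFun g) (cU g).hom v
    rw [reassoc_of% this]
  constructor
  · intro h v
    rw [Iso.eq_inv_comp, Functor.map_comp, Category.assoc, ← h, key]
  · intro h
    apply copower_hom_ext (k := k) (ρ.F g)
    intro v
    rw [key, h, Iso.hom_inv_id_assoc, Functor.map_comp, Category.assoc]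

end HomRep

/-! ### Splitting each summand ρ^t(V ⊗ Y) of L(V ⊗ Y) into copies of ρ^t(Y). -/

section Embeddings

variable {H : Subgroup G} [Finite (G ⧸ H)] {Y : C} {c : ∀ g : H, (ρ.F g).obj Y ≅ Y}
  {α : H → H → kˣ} (hα : ρ.IsFactorSet c α) {V : Type*} [AddCommGroup V] [Module k V]
  [FiniteDimensional k V] (π : ProjRep k α V) (σ : G ⧸ H → G) (hσ : ∀ q, (σ q : G ⧸ H) = q)

/-- The projection `V ⊗ Y → Y` given by a coordinate of `V`. -/
noncomputable def copowerπ (V : Type*) [AddCommGroup V] [Module k V] [FiniteDimensional k V]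
    (Y : C) (i : Fin (Module.finrank k V)) : copower k V Y ⟶ Y :=
  biproduct.π (fun _ : Fin (Module.finrank k V) => Y) i

lemma ins_copowerπ (Y : C) (v : V) (i : Fin (Module.finrank k V)) :
    ins V Y v ≫ copowerπ V Y i = (Module.finBasis k V).repr v i • 𝟙 Y := by
  have e : (Linear.rightComp k Y (copowerπ V Y i)).comp (ins V Y) =
      ((Module.finBasis k V).coord i).smulRight (𝟙 Y) := by
    classical
    apply (Module.finBasis k V).ext
    intro j
    change ins V Y _ ≫ biproduct.π _ i = _
    rw [ins_basis]
    refine (biproduct.ι_π (fun _ : Fin (Module.finrank k V) => Y) j i).trans ?_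
    by_cases h : j = i
    · subst h; simp
    · simp [h]
  exact LinearMap.congr_fun e v

lemma sum_copowerπ_ins (V : Type*) [AddCommGroup V] [Module k V] [FiniteDimensional k V] (Y : C) :
    ∑ i, copowerπ V Y i ≫ ins V Y (Module.finBasis k V i) = 𝟙 _ := by
  simp only [ins_basis]
  exact IsBilimit.total (biproduct.isBilimit fun _ : Fin (Module.finrank k V) => Y)

/-- The unit `V ⊗ Y → L(V ⊗ Y)` of the induction. -/
noncomputable def copowerUnit : copower k V Y ⟶ (induce (ofProjRep hα π) σ hσ).X :=
  induceUnit (ofProjRep hα π) σ hσ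

/-- The retraction `L(V ⊗ Y) → V ⊗ Y` of the unit of the induction. -/
noncomputable def copowerRetraction : (induce (ofProjRep hα π) σ hσ).X ⟶ copower k V Y :=
  induceRetraction (ofProjRep hα π) σ hσ

lemma copowerUnit_retraction :
    copowerUnit hα π σ hσ ≫ copowerRetraction hα π σ hσ = 𝟙 _ :=
  induceUnit_retraction (ofProjRep hα π) σ hσ

lemma copowerRetraction_unit : copowerRetraction hα π σ hσ ≫ copowerUnit hα π σ hσ =
    cosetProj (ofProjRep hα π) σ hσ ((1 : G) : G ⧸ H) :=
  induceRetraction_unit (ofProjRep hα π) σ hσ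

lemma map_copowerUnit_μ (h : H) :
    (ρ.F h).map (copowerUnit hα π σ hσ) ≫ (induce (ofProjRep hα π) σ hσ).μ h =
      copowerMap (π.toFun h) (c h).hom ≫ copowerUnit hα π σ hσ :=
  (μ_induceUnit (ofProjRep hα π) σ hσ h.2).symm

/-- The morphism `Y → L(V ⊗ Y)` given by a vector of `V`. -/
noncomputable def vecMap : V →ₗ[k] (Y ⟶ (induce (ofProjRep hα π) σ hσ).X) :=
  copowerHomEquiv V Y _ (copowerUnit hα π σ hσ)

lemma vecMap_apply (v : V) : vecMap hα π σ hσ v = ins V Y v ≫ copowerUnit hα π σ hσ := rfl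

/-- The morphism `L(V ⊗ Y) → Y` given by a coordinate of `V`. -/
noncomputable def vecProj (i : Fin (Module.finrank k V)) :
    (induce (ofProjRep hα π) σ hσ).X ⟶ Y :=
  copowerRetraction hα π σ hσ ≫ copowerπ V Y i

lemma vecMap_vecProj (v : V) (i : Fin (Module.finrank k V)) :
    vecMap hα π σ hσ v ≫ vecProj hα π σ hσ i = (Module.finBasis k V).repr v i • 𝟙 Y := by
  rw [vecMap_apply, vecProj, Category.assoc, reassoc_of% copowerUnit_retraction hα π σ hσ,
    ins_copowerπ]

lemma sum_vecProj_vecMap :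
    ∑ i, vecProj hα π σ hσ i ≫ vecMap hα π σ hσ (Module.finBasis k V i) =
      cosetProj (ofProjRep hα π) σ hσ ((1 : G) : G ⧸ H) := by
  have h (i) : vecProj hα π σ hσ i ≫ vecMap hα π σ hσ (Module.finBasis k V i) =
      copowerRetraction hα π σ hσ ≫ (copowerπ V Y i ≫ ins V Y (Module.finBasis k V i)) ≫
        copowerUnit hα π σ hσ := by
    simp only [vecProj, vecMap_apply, Category.assoc]
  rw [← copowerRetraction_unit, Finset.sum_congr rfl fun i _ => h i, ← Preadditive.comp_sum,
    ← Preadditive.sum_comp, sum_copowerπ_ins, Category.id_comp]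

lemma map_vecMap_μ (h : H) (v : V) :
    (ρ.F h).map (vecMap hα π σ hσ v) ≫ (induce (ofProjRep hα π) σ hσ).μ h =
      (c h).hom ≫ vecMap hα π σ hσ (π.toFun h v) := by
  have h1 := map_ins_copowerMap (ρ := ρ) (g := h) (π.toFun h) (c h).hom v
  rw [vecMap_apply, vecMap_apply, Functor.map_comp, Category.assoc, map_copowerUnit_μ,
    reassoc_of% h1]

/-- The morphism `ρ^t(Y) → L(V ⊗ Y)` given by a vector of `V`. -/
noncomputable def emb (t : G) : V →ₗ[k] ((ρ.F t).obj Y ⟶ (induce (ofProjRep hα π) σ hσ).X) :=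
  (Linear.rightComp k _ ((induce (ofProjRep hα π) σ hσ).μ t)).comp
    (((ρ.F t).mapLinearMap k).comp (vecMap hα π σ hσ))

lemma emb_apply (t : G) (v : V) :
    emb hα π σ hσ t v =
      (ρ.F t).map (vecMap hα π σ hσ v) ≫ (induce (ofProjRep hα π) σ hσ).μ t := rfl

/-- The morphism `L(V ⊗ Y) → ρ^t(Y)` given by a coordinate of `V`. -/
noncomputable def embProj (t : G) (i : Fin (Module.finrank k V)) :
    (induce (ofProjRep hα π) σ hσ).X ⟶ (ρ.F t).obj Y :=
  ((induce (ofProjRep hα π) σ hσ).iso t).inv ≫ (ρ.F t).map (vecProj hα π σ hσ i)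

lemma emb_embProj (t : G) (v : V) (i : Fin (Module.finrank k V)) :
    emb hα π σ hσ t v ≫ embProj hα π σ hσ t i = (Module.finBasis k V).repr v i • 𝟙 _ := by
  rw [emb_apply, embProj, ← EquivariantObject.iso_hom, Category.assoc, Iso.hom_inv_id_assoc,
    ← Functor.map_comp, vecMap_vecProj, Functor.map_smul, CategoryTheory.Functor.map_id]

/-- Transport by μ^t of the decomposition at the trivial coset. Here t is any element of its coset,
not necessarily the one chosen by σ; this frees the orbit representatives (t_i, s_i) from the
choices made in forming the induced objects. -/
lemma sum_embProj_emb (t : G) :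
    ∑ i, embProj hα π σ hσ t i ≫ emb hα π σ hσ t (Module.finBasis k V i) =
      cosetProj (ofProjRep hα π) σ hσ (t : G ⧸ H) := by
  simp only [emb_apply, embProj, Category.assoc]
  rw [← Preadditive.comp_sum]
  simp only [← Functor.map_comp_assoc]
  rw [← Preadditive.sum_comp, ← Functor.map_sum, sum_vecProj_vecMap, map_cosetProj,
    Iso.inv_comp_eq, MulAction.Quotient.smul_coe, smul_eq_mul, mul_one]
  rfl

lemma map_emb_μ (g t : G) (v : V) :
    (ρ.F g).map (emb hα π σ hσ t v) ≫ (induce (ofProjRep hα π) σ hσ).μ g =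
      (ρ.mulIso (rfl : g * t = g * t)).hom.app Y ≫ emb hα π σ hσ (g * t) v := by
  have nat := (ρ.mulIso (rfl : g * t = g * t)).hom.naturality (vecMap hα π σ hσ v)
  rw [Functor.comp_map] at nat
  rw [emb_apply, emb_apply, Functor.map_comp, Category.assoc, EquivariantObject.map_mul,
    reassoc_of% nat]

/-- The structure map `μ^g` acts on the summand `ρ^t(V ⊗ Y)` of `L(V ⊗ Y)`, for `g ∈ t H t⁻¹`, by
`ᵗπ(g) ⊗ (ᵗc)^g`. -/
lemma map_emb_μ_conj (t : G) (g : ↥(MulAut.conj t • H)) (v : V) :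
    (ρ.F g).map (emb hα π σ hσ t v) ≫ (induce (ofProjRep hα π) σ hσ).μ g =
      (conjFamily c t g).hom ≫ emb hα π σ hσ t (π.toFun (conjHom t H g) v) := by
  have e : t * (conjHom t H g : G) = g * t := by simp [conjHom, mul_assoc]
  -- Rewriting gt as t · (t⁻¹gt) lets the element t⁻¹gt of H act first, through π and c; translation
  -- by t then follows.
  have h1 : (ρ.mulIso e).hom.app Y ≫ emb hα π σ hσ (g * t) v =
      (ρ.F t).map (c (conjHom t H g)).hom ≫ emb hα π σ hσ t (π.toFun (conjHom t H g) v) := by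
    have nat := (ρ.mulIso e).hom.naturality (vecMap hα π σ hσ v)
    rw [Functor.comp_map] at nat
    rw [emb_apply, emb_apply, ← reassoc_of% nat, ← EquivariantObject.map_mul' _ e,
      ← Functor.map_comp_assoc, ← Functor.map_comp_assoc, map_vecMap_μ]
  have h2 : emb hα π σ hσ (g * t) v = (ρ.mulIso e).inv.app Y ≫
      (ρ.F t).map (c (conjHom t H g)).hom ≫ emb hα π σ hσ t (π.toFun (conjHom t H g) v) := by
    rw [← h1, Iso.inv_hom_id_app_assoc]
  rw [map_emb_μ, h2]
  simp [conjFamily]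

end Embeddings

end CatAction

/-! ### The system of imprimitivity on Hom(U, S_{Y,π} ⊗ S_{Z,γ}). -/

namespace TensorAction

open CatAction Functor.OplaxMonoidal
open scoped TensorProduct

variable {k : Type*} [Field k] {G : Type*} [Group G] {C : Type*} [Category* C]
  [Abelian C] [Linear k C] [MonoidalCategory C]

/-- An element fixes the coset tH exactly when it lies in tHt⁻¹; applied to both coordinates, this
identifies the stabilizer in G_U with T. -/
lemma smul_pair_eq_iff (ρ : TensorAction k G C) {U Y Z : C} (t s : G)
    (g : ρ.inertia U) :
    g • ((t : G ⧸ ρ.inertia Y), (s : G ⧸ ρ.inertia Z)) =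
        ((t : G ⧸ ρ.inertia Y), (s : G ⧸ ρ.inertia Z)) ↔
      ∃ a, ρ.toU U Y Z t s a = g := by
  have key (H : Subgroup G) (t : G) : (g : G) • (t : G ⧸ H) = t ↔
      (g : G) ∈ MulAut.conj t • H := by
    rw [Subgroup.mem_pointwise_smul_iff_inv_smul_mem, eq_comm, MulAction.Quotient.smul_coe,
      QuotientGroup.eq, ← map_inv, MulAut.smul_def, MulAut.conj_apply, inv_inv, smul_eq_mul,
      mul_assoc]
  constructor
  · intro h
    exact ⟨⟨g, ⟨g.2, (key _ _).1 (congrArg Prod.fst h)⟩, (key _ _).1 (congrArg Prod.snd h)⟩, rfl⟩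
  · rintro ⟨a, rfl⟩
    exact Prod.ext ((key _ _).2 a.2.1.2) ((key _ _).2 a.2.2)

variable [MonoidalPreadditive C] [MonoidalLinear k C]

/-- The tensor product of morphisms as a bilinear map. -/
def tensorHomBilin (X X' Y Y' : C) : (X ⟶ X') →ₗ[k] (Y ⟶ Y') →ₗ[k] (X ⊗ Y ⟶ X' ⊗ Y') :=
  LinearMap.mk₂ k (fun f g => f ⊗ₘ g) (fun _ _ _ => MonoidalPreadditive.add_tensor _ _ _)
    (fun r f g => by simpa using smul_tensor_smul r 1 f g)
    (fun _ _ _ => MonoidalPreadditive.tensor_add _ _ _)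
    (fun r f g => by simpa using smul_tensor_smul 1 r f g)

variable {ρ : TensorAction k G C} {U Y Z : C}
  {cU : ∀ g : ρ.inertia U, (ρ.F g).obj U ≅ U} {cY : ∀ g : ρ.inertia Y, (ρ.F g).obj Y ≅ Y}
  {cZ : ∀ g : ρ.inertia Z, (ρ.F g).obj Z ≅ Z}
  {αU : ρ.inertia U → ρ.inertia U → kˣ} {αY : ρ.inertia Y → ρ.inertia Y → kˣ}
  {αZ : ρ.inertia Z → ρ.inertia Z → kˣ}
  (hU : ρ.IsFactorSet cU αU) (hY : ρ.IsFactorSet cY αY) (hZ : ρ.IsFactorSet cZ αZ)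
  {Vπ Vγ : Type*} [AddCommGroup Vπ] [Module k Vπ] [AddCommGroup Vγ] [Module k Vγ]
  (π : ProjRep k αY Vπ) (γ : ProjRep k αZ Vγ)
  (σY : G ⧸ ρ.inertia Y → G) (hσY : ∀ q, (σY q : G ⧸ ρ.inertia Y) = q)
  (σZ : G ⧸ ρ.inertia Z → G) (hσZ : ∀ q, (σZ q : G ⧸ ρ.inertia Z) = q)

/-- For equivariant objects `A` and `B`, the projective representation on `Hom(U, A ⊗ B)`. -/
noncomputable def tensorHomRep (A B : EquivariantObject ρ.toCatAction) :
    ProjRep k αU (U ⟶ A.X ⊗ B.X) :=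
  equivariantHomRep hU (ρ.tensor A B)

lemma tensorHomRep_apply (A B : EquivariantObject ρ.toCatAction) (g : ρ.inertia U)
    (f : U ⟶ A.X ⊗ B.X) :
    (tensorHomRep hU A B).toFun g f =
      (cU g).inv ≫ (ρ.F g).map f ≫ δ (ρ.F g) A.X B.X ≫ (A.μ g ⊗ₘ B.μ g) := rfl

lemma tensorHomRep_comp_tensorHom (A B : EquivariantObject ρ.toCatAction) (g : ρ.inertia U)
    {M N : C} (f : U ⟶ M ⊗ N) (a : M ⟶ A.X) (b : N ⟶ B.X) :
    (tensorHomRep hU A B).toFun g (f ≫ (a ⊗ₘ b)) =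
      (cU g).inv ≫ (ρ.F g).map f ≫ δ (ρ.F g) M N ≫
        (((ρ.F g).map a ≫ A.μ g) ⊗ₘ ((ρ.F g).map b ≫ B.μ g)) := by
  rw [tensorHomRep_apply, Functor.map_comp, Category.assoc, ← δ_natural_assoc,
    tensorHom_comp_tensorHom]

/-- Accounts for the nonvanishing condition in the sum: a zero Hom space makes the target of the
intertwiners zero. -/
lemma mult_productRep_eq_zero {Vδ : Type*} [AddCommGroup Vδ] [Module k Vδ]
    (δ : ProjRep k αU Vδ) {t s : G}
    (h : ¬ ∃ f : U ⟶ (ρ.F t).obj Y ⊗ (ρ.F s).obj Z, f ≠ 0) :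
    (δ.comap (ρ.toU U Y Z t s)).mult (ρ.productRep hU hY hZ π γ t s) = 0 := by
  push Not at h
  have : Subsingleton (U ⟶ (ρ.F t).obj Y ⊗ (ρ.F s).obj Z) :=
    subsingleton_of_forall_eq 0 h
  exact Module.finrank_zero_of_subsingleton

variable [Finite G] [FiniteDimensional k Vπ] [FiniteDimensional k Vγ]

/-- The projection of `Hom(U, S_{Y,π} ⊗ S_{Z,γ})` to the summand of a pair of cosets. -/
noncomputable def pairProj (U : C) (x : (G ⧸ ρ.inertia Y) × (G ⧸ ρ.inertia Z)) :
    (U ⟶ (induce (ofProjRep hY π) σY hσY).X ⊗ (induce (ofProjRep hZ γ) σZ hσZ).X) →ₗ[k]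
      (U ⟶ (induce (ofProjRep hY π) σY hσY).X ⊗ (induce (ofProjRep hZ γ) σZ hσZ).X) :=
  Linear.rightComp k U
    (cosetProj (ofProjRep hY π) σY hσY x.1 ⊗ₘ cosetProj (ofProjRep hZ γ) σZ hσZ x.2)

lemma pairProj_apply (x : (G ⧸ ρ.inertia Y) × (G ⧸ ρ.inertia Z))
    (w : U ⟶ (induce (ofProjRep hY π) σY hσY).X ⊗ (induce (ofProjRep hZ γ) σZ hσZ).X) :
    pairProj hY hZ π γ σY hσY σZ hσZ U x w = w ≫
      (cosetProj (ofProjRep hY π) σY hσY x.1 ⊗ₘ cosetProj (ofProjRep hZ γ) σZ hσZ x.2) := rfl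

lemma sum_pairProj [Fintype (G ⧸ ρ.inertia Y)] [Fintype (G ⧸ ρ.inertia Z)]
    (w : U ⟶ (induce (ofProjRep hY π) σY hσY).X ⊗ (induce (ofProjRep hZ γ) σZ hσZ).X) :
    ∑ x, pairProj hY hZ π γ σY hσY σZ hσZ U x w = w := by
  simp only [pairProj_apply]
  rw [← Preadditive.comp_sum, Fintype.sum_prod_type]
  simp only [← tensor_sum, ← sum_tensor, sum_cosetProj]
  simp

lemma pairProj_pairProj_of_ne {x y : (G ⧸ ρ.inertia Y) × (G ⧸ ρ.inertia Z)} (h : x ≠ y)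
    (w : U ⟶ (induce (ofProjRep hY π) σY hσY).X ⊗ (induce (ofProjRep hZ γ) σZ hσZ).X) :
    pairProj hY hZ π γ σY hσY σZ hσZ U x (pairProj hY hZ π γ σY hσY σZ hσZ U y w) = 0 := by
  rw [pairProj_apply, pairProj_apply, Category.assoc, tensorHom_comp_tensorHom]
  by_cases h1 : y.1 = x.1
  · have h2 : y.2 ≠ x.2 := fun e => h (Prod.ext h1.symm e.symm)
    rw [cosetProj_comp_of_ne (ofProjRep hZ γ) σZ hσZ h2, MonoidalPreadditive.tensor_zero,
      comp_zero]
  · rw [cosetProj_comp_of_ne (ofProjRep hY π) σY hσY h1, MonoidalPreadditive.zero_tensor,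
      comp_zero]

/-- Naturality of the monoidal structure of ρ^g reduces this to `map_cosetProj` in each factor; the
action on pairs of cosets is diagonal. -/
lemma tensorHomRep_pairProj (g : ρ.inertia U) (x : (G ⧸ ρ.inertia Y) × (G ⧸ ρ.inertia Z))
    (w : U ⟶ (induce (ofProjRep hY π) σY hσY).X ⊗ (induce (ofProjRep hZ γ) σZ hσZ).X) :
    (tensorHomRep hU (induce (ofProjRep hY π) σY hσY) (induce (ofProjRep hZ γ) σZ hσZ)).toFun g
        (pairProj hY hZ π γ σY hσY σZ hσZ U x w) =
      pairProj hY hZ π γ σY hσY σZ hσZ U (g • x)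
        ((tensorHomRep hU (induce (ofProjRep hY π) σY hσY) (induce (ofProjRep hZ γ) σZ hσZ)).toFun g w) := by
  rw [pairProj_apply, pairProj_apply, tensorHomRep_comp_tensorHom, map_cosetProj,
    map_cosetProj, tensorHomRep_apply, ← tensorHom_comp_tensorHom]
  simp only [Category.assoc]
  rfl

/-- The map `V_π ⊗ V_γ ⊗ Hom(U, ρ^t(Y) ⊗ ρ^s(Z)) → Hom(U, S_{Y,π} ⊗ S_{Z,γ})`. -/
noncomputable def pairEmb (U : C) (t s : G) :
    (Vπ ⊗[k] Vγ) ⊗[k] (U ⟶ (ρ.F t).obj Y ⊗ (ρ.F s).obj Z) →ₗ[k]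
      (U ⟶ (induce (ofProjRep hY π) σY hσY).X ⊗ (induce (ofProjRep hZ γ) σZ hσZ).X) :=
  TensorProduct.lift ((Linear.comp U _ _).flip.comp (TensorProduct.lift
    ((tensorHomBilin (k := k) _ _ _ _).compl₁₂ (emb hY π σY hσY t) (emb hZ γ σZ hσZ s))))

lemma pairEmb_tmul (t s : G) (v : Vπ) (w : Vγ) (f : U ⟶ (ρ.F t).obj Y ⊗ (ρ.F s).obj Z) :
    pairEmb hY hZ π γ σY hσY σZ hσZ U t s ((v ⊗ₜ w) ⊗ₜ f) =
      f ≫ (emb hY π σY hσY t v ⊗ₘ emb hZ γ σZ hσZ s w) := rfl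

/-- The map `Hom(U, S_{Y,π} ⊗ S_{Z,γ}) → V_π ⊗ V_γ ⊗ Hom(U, ρ^t(Y) ⊗ ρ^s(Z))` whose coordinates
are given by the projections to `ρ^t(Y)` and `ρ^s(Z)`. -/
noncomputable def pairRetraction (U : C) (t s : G) :
    (U ⟶ (induce (ofProjRep hY π) σY hσY).X ⊗ (induce (ofProjRep hZ γ) σZ hσZ).X) →ₗ[k]
      (Vπ ⊗[k] Vγ) ⊗[k] (U ⟶ (ρ.F t).obj Y ⊗ (ρ.F s).obj Z) :=
  ∑ i, ∑ j, (TensorProduct.mk k _ _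
    (Module.finBasis k Vπ i ⊗ₜ Module.finBasis k Vγ j)).comp
      (Linear.rightComp k U (embProj hY π σY hσY t i ⊗ₘ embProj hZ γ σZ hσZ s j))

lemma pairRetraction_apply (t s : G)
    (w : U ⟶ (induce (ofProjRep hY π) σY hσY).X ⊗ (induce (ofProjRep hZ γ) σZ hσZ).X) :
    pairRetraction hY hZ π γ σY hσY σZ hσZ U t s w =
      ∑ i, ∑ j, (Module.finBasis k Vπ i ⊗ₜ Module.finBasis k Vγ j) ⊗ₜ
        (w ≫ (embProj hY π σY hσY t i ⊗ₘ embProj hZ γ σZ hσZ s j)) := by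
  rw [pairRetraction]
  simp only [LinearMap.sum_apply]
  rfl

/-- With `pairEmb_pairRetraction`, this identifies the block of (t, s) with V_π ⊗ V_γ ⊗ Hom(U, ρ^tY
⊗ ρ^sZ). On a pure tensor the projections read off the coordinates of the two vectors, which the
chosen bases reassemble. -/
lemma pairRetraction_pairEmb (t s : G)
    (x : (Vπ ⊗[k] Vγ) ⊗[k] (U ⟶ (ρ.F t).obj Y ⊗ (ρ.F s).obj Z)) :
    pairRetraction hY hZ π γ σY hσY σZ hσZ U t s
      (pairEmb hY hZ π γ σY hσY σZ hσZ U t s x) = x := by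
  refine LinearMap.congr_fun (f := (pairRetraction hY hZ π γ σY hσY σZ hσZ U t s).comp
    (pairEmb hY hZ π γ σY hσY σZ hσZ U t s)) (g := LinearMap.id) ?_ x
  refine TensorProduct.ext_threefold fun v w f => ?_
  rw [LinearMap.comp_apply, pairEmb_tmul, pairRetraction_apply]
  simp only [Category.assoc, tensorHom_comp_tensorHom, emb_embProj, smul_tensor_smul,
    id_tensorHom_id, Linear.comp_smul, Category.comp_id, LinearMap.id_apply]
  conv_rhs => rw [← (Module.finBasis k Vπ).sum_repr v, ← (Module.finBasis k Vγ).sum_repr w]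
  simp only [TensorProduct.sum_tmul, TensorProduct.tmul_sum, TensorProduct.tmul_smul,
    TensorProduct.smul_tmul', Finset.smul_sum, smul_smul]
  rw [Finset.sum_comm]
  exact Finset.sum_congr rfl fun j _ => Finset.sum_congr rfl fun i _ => by rw [mul_comm]

lemma pairEmb_pairRetraction (t s : G) (w : U ⟶ (induce (ofProjRep hY π) σY hσY).X ⊗ (induce (ofProjRep hZ γ) σZ hσZ).X) :
    pairEmb hY hZ π γ σY hσY σZ hσZ U t s
      (pairRetraction hY hZ π γ σY hσY σZ hσZ U t s w) =
        pairProj hY hZ π γ σY hσY σZ hσZ U ((t : G ⧸ ρ.inertia Y), (s : G ⧸ ρ.inertia Z)) w := by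
  rw [pairRetraction_apply, pairProj_apply, ← sum_embProj_emb, ← sum_embProj_emb]
  simp only [map_sum, pairEmb_tmul, Category.assoc, tensorHom_comp_tensorHom, sum_tensor,
    tensor_sum, Preadditive.comp_sum]
  exact Finset.sum_comm

/-- For g in T, moving μ^g past the embeddings replaces v by ᵗπ(g)v and w by ˢγ(g)w, at the cost of
(ᵗc_Y)^g and (ˢc_Z)^g. These absorb into f and form precisely the action τ. -/
lemma tensorHomRep_pairEmb (t s : G) (g : ρ.stab U Y Z t s)
    (x : (Vπ ⊗[k] Vγ) ⊗[k] (U ⟶ (ρ.F t).obj Y ⊗ (ρ.F s).obj Z)) :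
    (tensorHomRep hU (induce (ofProjRep hY π) σY hσY) (induce (ofProjRep hZ γ) σZ hσZ)).toFun (ρ.toU U Y Z t s g)
        (pairEmb hY hZ π γ σY hσY σZ hσZ U t s x) =
      pairEmb hY hZ π γ σY hσY σZ hσZ U t s
        ((ρ.productRep hU hY hZ π γ t s).toFun g x) := by
  refine LinearMap.congr_fun (f := ((tensorHomRep hU (induce (ofProjRep hY π) σY hσY)
    (induce (ofProjRep hZ γ) σZ hσZ)).toFun (ρ.toU U Y Z t s g)).comp
      (pairEmb hY hZ π γ σY hσY σZ hσZ U t s)) (g := (pairEmb hY hZ π γ σY hσY σZ hσZ U t s).comp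
        ((ρ.productRep hU hY hZ π γ t s).toFun g)) ?_ x
  refine TensorProduct.ext_threefold fun v w f => ?_
  have h1 := map_emb_μ_conj hY π σY hσY t (ρ.toY U Y Z t s g) v
  have h2 := map_emb_μ_conj hZ γ σZ hσZ s (ρ.toZ U Y Z t s g) w
  -- Stated over the underlying element of G with arbitrary a and b, because g is viewed in T, in
  -- tG_Yt⁻¹ and in sG_Zs⁻¹ at once.
  have key (a : (ρ.F (g : G)).obj ((ρ.F t).obj Y) ⟶ (ρ.F t).obj Y)
      (b : (ρ.F (g : G)).obj ((ρ.F s).obj Z) ⟶ (ρ.F s).obj Z) (v' : Vπ) (w' : Vγ)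
      (ha : (ρ.F (g : G)).map (emb hY π σY hσY t v) ≫ (induce (ofProjRep hY π) σY hσY).μ (g : G) =
        a ≫ emb hY π σY hσY t v')
      (hb : (ρ.F (g : G)).map (emb hZ γ σZ hσZ s w) ≫ (induce (ofProjRep hZ γ) σZ hσZ).μ (g : G) =
        b ≫ emb hZ γ σZ hσZ s w') (c : U ⟶ (ρ.F (g : G)).obj U) :
      c ≫ (ρ.F (g : G)).map f ≫ δ (ρ.F (g : G)) _ _ ≫
        (((ρ.F (g : G)).map (emb hY π σY hσY t v) ≫ (induce (ofProjRep hY π) σY hσY).μ (g : G)) ⊗ₘ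
          ((ρ.F (g : G)).map (emb hZ γ σZ hσZ s w) ≫
            (induce (ofProjRep hZ γ) σZ hσZ).μ (g : G))) =
        (c ≫ (ρ.F (g : G)).map f ≫ δ (ρ.F (g : G)) _ _ ≫ (a ⊗ₘ b)) ≫
          (emb hY π σY hσY t v' ⊗ₘ emb hZ γ σZ hσZ s w') := by
    rw [ha, hb, ← tensorHom_comp_tensorHom]
    simp only [Category.assoc]
  rw [LinearMap.comp_apply, pairEmb_tmul, tensorHomRep_comp_tensorHom]
  exact key _ _ _ _ h1 h2 _

/-- The multiplicity formula, summed over all orbits. -/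
theorem finrank_hom_tensor_eq_sum [CharZero k] (hfin : ∀ A B : C, FiniteDimensional k (A ⟶ B))
    {Vδ : Type*} [AddCommGroup Vδ] [Module k Vδ] [FiniteDimensional k Vδ]
    (δ : ProjRep k αU Vδ)
    (σU : G ⧸ ρ.inertia U → G) (hσU : ∀ q, (σU q : G ⧸ ρ.inertia U) = q)
    {ι : Type*} [Fintype ι] (t s : ι → G)
    (hts : Function.Bijective fun i =>
      (Quotient.mk _ ((t i : G ⧸ ρ.inertia Y), (s i : G ⧸ ρ.inertia Z)) :
        MulAction.orbitRel.Quotient (ρ.inertia U) ((G ⧸ ρ.inertia Y) × (G ⧸ ρ.inertia Z)))) :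
    Module.finrank k (simpleObject hU δ σU hσU ⟶
        ρ.tensor (simpleObject hY π σY hσY) (simpleObject hZ γ σZ hσZ)) =
      ∑ i, (δ.comap (ρ.toU U Y Z (t i) (s i))).mult (ρ.productRep hU hY hZ π γ (t i) (s i)) := by
  have := Fintype.ofFinite (G ⧸ ρ.inertia Y)
  have := Fintype.ofFinite (G ⧸ ρ.inertia Z)
  refine (induceHomEquiv (ofProjRep hU δ) σU hσU
    (ρ.tensor (induce (ofProjRep hY π) σY hσY) (induce (ofProjRep hZ γ) σZ hσZ))).finrank_eq.trans ?_
  rw [finrank_homs_ofProjRep]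
  -- Mackey decomposition for G_U acting on pairs of cosets; `hfin` makes the blocks
  -- finite-dimensional.
  exact ProjRep.mult_eq_sum δ (tensorHomRep hU _ _) (pairProj hY hZ π γ σY hσY σZ hσZ U)
    (sum_pairProj hY hZ π γ σY hσY σZ hσZ)
    (fun x y h w => pairProj_pairProj_of_ne hY hZ π γ σY hσY σZ hσZ h w)
    (tensorHomRep_pairProj hU hY hZ π γ σY hσY σZ hσZ) _ hts
    (fun i => ρ.toU U Y Z (t i) (s i)) (fun i => Subgroup.inclusion_injective _)
    (fun i g => ρ.smul_pair_eq_iff (t i) (s i) g) (fun i => ρ.productRep hU hY hZ π γ (t i) (s i))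
    (fun i => pairEmb hY hZ π γ σY hσY σZ hσZ U (t i) (s i))
    (fun i => pairRetraction hY hZ π γ σY hσY σZ hσZ U (t i) (s i))
    (fun i => pairRetraction_pairEmb hY hZ π γ σY hσY σZ hσZ (t i) (s i))
    (fun i => pairEmb_pairRetraction hY hZ π γ σY hσY σZ hσZ (t i) (s i))
    (fun i => tensorHomRep_pairEmb hU hY hZ π γ σY hσY σZ hσZ (t i) (s i))

end TensorAction

end Equivariantization

/-! ### Regrouping the orbits by double cosets. -/

theorem theorem3p9 {k : Type*} [Field k] [IsAlgClosed k] [CharZero k]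
    {C : Type*} [Category* C] [Abelian C] [Linear k C] [MonoidalCategory C]
    [MonoidalPreadditive C] [MonoidalLinear k C] [RigidCategory C]
    [Equivariantization.FusionCategory k C]
    {G : Type*} [Group G] [Finite G] (ρ : Equivariantization.TensorAction k G C)
    (U Y Z : C) [Simple U] [Simple Y] [Simple Z]
    -- choices of isomorphisms `c^g : ρ^g(X) ≅ X` for `X = U, Y, Z` and their factor sets
    (cU : ∀ g : ρ.inertia U, (ρ.F g).obj U ≅ U) (αU : ρ.inertia U → ρ.inertia U → kˣ)
    (hU : ρ.IsFactorSet cU αU)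
    (cY : ∀ g : ρ.inertia Y, (ρ.F g).obj Y ≅ Y) (αY : ρ.inertia Y → ρ.inertia Y → kˣ)
    (hY : ρ.IsFactorSet cY αY)
    (cZ : ∀ g : ρ.inertia Z, (ρ.F g).obj Z ≅ Z) (αZ : ρ.inertia Z → ρ.inertia Z → kˣ)
    (hZ : ρ.IsFactorSet cZ αZ)
    -- irreducible projective representations of the inertia subgroups with these factor sets
    {Vδ Vπ Vγ : Type*} [AddCommGroup Vδ] [Module k Vδ] [FiniteDimensional k Vδ]
    [AddCommGroup Vπ] [Module k Vπ] [FiniteDimensional k Vπ]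
    [AddCommGroup Vγ] [Module k Vγ] [FiniteDimensional k Vγ]
    (δ : Equivariantization.ProjRep k αU Vδ) (hδ : δ.IsIrreducible)
    (π : Equivariantization.ProjRep k αY Vπ) (hπ : π.IsIrreducible)
    (γ : Equivariantization.ProjRep k αZ Vγ) (hγ : γ.IsIrreducible)
    -- representatives of the left cosets of the inertia subgroups, used to form `S_{X,-}`
    (σU : G ⧸ ρ.inertia U → G) (hσU : ∀ q, (σU q : G ⧸ ρ.inertia U) = q)
    (σY : G ⧸ ρ.inertia Y → G) (hσY : ∀ q, (σY q : G ⧸ ρ.inertia Y) = q)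
    (σZ : G ⧸ ρ.inertia Z → G) (hσZ : ∀ q, (σZ q : G ⧸ ρ.inertia Z) = q)
    -- representatives of the distinct `G_U`-orbits in `G/G_Y × G/G_Z`
    (n : ℕ) (t s : Fin n → G)
    (hts : Function.Bijective fun i : Fin n =>
      (Quotient.mk _ ((t i : G ⧸ ρ.inertia Y), (s i : G ⧸ ρ.inertia Z)) :
        MulAction.orbitRel.Quotient (ρ.inertia U) ((G ⧸ ρ.inertia Y) × (G ⧸ ρ.inertia Z)))) :
    Module.finrank k
        (ρ.simpleObject hU δ σU hσU ⟶
          ρ.tensor (ρ.simpleObject hY π σY hσY) (ρ.simpleObject hZ γ σZ hσZ)) =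
      ∑ᶠ D : DoubleCoset.Quotient (ρ.inertia Y : Set G) (ρ.inertia Z : Set G),
        ∑ᶠ (i : Fin n) (_ : DoubleCoset.mk (ρ.inertia Y) (ρ.inertia Z) ((t i)⁻¹ * s i) = D ∧
            ∃ f : U ⟶ (ρ.F (t i)).obj Y ⊗ (ρ.F (s i)).obj Z, f ≠ 0),
          (δ.comap (ρ.toU U Y Z (t i) (s i))).mult
            (ρ.productRep hU hY hZ π γ (t i) (s i)) := by
  classical
  have : Finite (DoubleCoset.Quotient (ρ.inertia Y : Set G) (ρ.inertia Z : Set G)) :=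
    Quotient.finite _
  have := Fintype.ofFinite (DoubleCoset.Quotient (ρ.inertia Y : Set G) (ρ.inertia Z : Set G))
  rw [Equivariantization.TensorAction.finrank_hom_tensor_eq_sum hU hY hZ π γ σY hσY σZ hσZ
    (Equivariantization.FusionCategory.finite_hom (k := k)) δ σU hσU t s hts,
    finsum_eq_sum_of_fintype]
  simp only [finsum_eq_sum_of_fintype, finsum_eq_if]
  -- Each index i determines a single double coset, so after the exchange the inner sum over D has
  -- at most one nonzero term.
  rw [Finset.sum_comm]
  refine Finset.sum_congr rfl fun i _ => ?_
  by_cases h : ∃ f : U ⟶ (ρ.F (t i)).obj Y ⊗ (ρ.F (s i)).obj Z, f ≠ 0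
  · simp only [h, and_true, Finset.sum_ite_eq, Finset.mem_univ, if_true]
  · simp only [h, and_false, if_false, Finset.sum_const_zero]
    exact Equivariantization.TensorAction.mult_productRep_eq_zero hU hY hZ π γ δ h
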